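/- **Setting.** For $0<m<1$ let $K(m)=\int_0^{\pi/2}\frac{ds}{\sqrt{1-m\sin^2 s}}$ and $E(m)=\int_0^{\pi/2}\sqrt{1-m\sin^2 s}\,ds$. For $r=(r_1,r_2,r_3)$ with $r_1<r_2<r_3$ put $$m=\tfrac{r_2-r_1}{r_3-r_1},\quad k=\tfrac{\sqrt{r_3-r_1}}{2K(m)},\quad V=2(r_1+r_2+r_3),\quad Q_0=r_2-(r_3-r_1)+2(r_3-r_1)\tfrac{E(m)}{K(m)},$$ $$C_1=r_1^2+r_2^2+r_3^2-2(r_1r_2+r_2r_3+r_3r_1),$$ $$C_2=2\bigl(-r_1^3-r_2^3-r_3^3+r_1^2(r_2+r_3)+r_2^2(r_3+r_1)+r_3^2(r_1+r_2)-2r_1r_2r_3\bigr),$$ and let $\partial_jk=\partial k/\partial r_j$, $v_j=V+2k/\partial_jk=\partial_j(kV)/\partial_jk$. Let $\Omega\subset\mathbb R^2$ be open, and let $r_j(x,t)$, $Q(x,t)$ be smooth on $\Omega$ with $r_1<r_2<r_3$. With $P=VQ+C_1$ and $Q_d=\frac{3\partial_x(k\,\partial_xQ)+\partial_{xx}k\,Q}{k}$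 put $$\Phi_1=\partial_x\Bigl(2\partial_{xx}Q+\tfrac{3\partial_xk}{k}\partial_xQ+\tfrac{\partial_{xx}k}{k}Q\Bigr),$$ $$\Phi_2=\partial_tQ_d+\partial_x\Bigl(VQ_d+\tfrac{\partial_{xx}P}{2}+\tfrac{3\partial_xk}{2k}\partial_xP+\tfrac{\partial_{xx}k}{k}P\Bigr)-\epsilon^2\partial_x\Bigl(\tfrac{(k\partial_{xx}+3\partial_xk\,\partial_x+2\partial_{xx}k)Q_d}{2k}\Bigr).$$ The all-orders Whitham equations for the KdV equation $\partial_tu+6u\,\partial_xu+\epsilon^2\partial_{xxx}u=0$ are $$\partial_tk+\partial_x(kV)=0,\qquad \partial_tQ+\partial_xP-\epsilon^2\Phi_1=0,\qquad \partial_tP+\partial_x(VP-3C_2)-\epsilon^2\Phi_2=0;$$ the classical system is the case $\epsilon=0$, $Q=Q_0$. **Claim.** (1) $k>0$ and $\partial_jk\ne0$ for $j=1,2,3$ whenever $r_1<r_2<r_3$; the classical system holds at a point of $\Omega$ if and only if $\partial_tr_j+v_j\,\partial_xr_j=0$ there for $j=1,2,3$. (2) For $\epsilon\neq0$ let $q=(Q-Q_0)/\epsilon^2$.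 At every point of $\Omega$ the all-orders Whitham equations are equivalent to $$\partial_tr_j+v_j\,\partial_xr_j+\frac{\epsilon^2\bigl(X_2+6(r_j-r_l-r_m)X_1\bigr)}{24(r_j-r_l)(r_j-r_m)\,\partial_jk/k}=0,\qquad \{j,l,m\}=\{1,2,3\},\quad j=1,2,3,\tag{W}$$ where $X_1=\partial_tq+\partial_x(Vq)-\Phi_1$ and $X_2=\partial_t(Vq)+\partial_x(V^2q)-\Phi_2$. (3) Write $'$ for $\partial_\theta$ and $\overline f=\int_{-1/2}^{1/2}f\,d\theta$ (the average over a period). Let $u_0=\lambda_2+(\lambda_3-\lambda_2)\,\mathrm{cn}^2(2K(m)\theta;m)$ with $\lambda_2=r_1-r_2+r_3$, $\lambda_3=-r_1+r_2+r_3$, and let $u_n(\theta,x,t)$, $n\ge1$, be smooth solutions of $$k^2u_n''+(6u_0-V)u_n+F_n=0,\qquad u_n'|_{\theta=0}=0\ (n\ge1),\qquad u_n|_{\theta=0}=0\ (n \text{ odd}),$$ $$kF_n=3k\sum_{i=1}^{n-1}u_iu_{n-i}+\partial_t\hat J_1^{n-1}+3\partial_x\hat J_2^{n-1}+3k\,\partial_x(ku_{n-1}')+(3k\partial_{xx}+3\partial_xk\,\partial_x+\partial_{xx}k)u_{n-2}+\partial_{xxx}\hat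 J_1^{n-3}$$ (terms with a negative index are $0$), where $\hat J_1^{n}$ and $\hat J_2^{n}$ are the antiderivatives in $\theta$, of zero average, of $f-\overline f$ for $f=u_n$ and for $f=\sum_{i=0}^nu_iu_{n-i}$. Then $\overline{u_0}=Q_0$, and every $u_{2n+1}$ is odd in $\theta$, so $\overline{u_{2n+1}}=0$ (and, if $u_{2n+1}$ is 1-periodic in $\theta$, its integral over every interval of length $1$ vanishes). Consequently, for every $N\ge0$ and every continuous $w(\theta)$, $$\overline{\sum_{n=0}^{2N+1}\epsilon^nu_n+\epsilon^{2N+2}w}=Q_0+\sum_{i=1}^N\epsilon^{2i}\,\overline{u_{2i}}+\epsilon^{2N+2}\,\overline w .$$ (4) The first nontrivial corrections are of order $\epsilon^2$. Let $r_j$, $u_n$ as in (3) and $w(\theta,x,t)$ depend on a parameter $\epsilon$, smoothly in all variables jointly, for $\epsilon$ in an open interval $(-\epsilon_0,\epsilon_0)$, with $r_1<r_2<r_3$ throughout this interval and the conditions of (3) on $u_n$ holding for $0<\epsilon<\epsilon_0$; let $Q=\overline{u_0+\epsilon u_1+\epsilon^2u_2+\epsilon^3u_3+\epsilon^4w}$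 for such $\epsilon$. Then the left-hand side of (W) with $q=(Q-Q_0)/\epsilon^2$ differs by $O(\epsilon^4)$ as $\epsilon\to0^+$, uniformly on compact subsets of $\Omega$, from the same expression with, writing $q_2=\overline{u_2}$, $P_0=VQ_0+C_1$ and $Q_d^0=\frac{3\partial_x(k\partial_xQ_0)+\partial_{xx}k\,Q_0}{k}$, $$X_1=\partial_tq_2+\partial_x(Vq_2)-\partial_x\Bigl(2\partial_{xx}Q_0+\tfrac{3\partial_xk}{k}\partial_xQ_0+\tfrac{\partial_{xx}k}{k}Q_0\Bigr),$$ $$X_2=\partial_t(Vq_2)+\partial_x(V^2q_2)-\partial_tQ_d^0-\partial_x\Bigl(VQ_d^0+\tfrac{\partial_{xx}P_0}{2}+\tfrac{3\partial_xk}{2k}\partial_xP_0+\tfrac{\partial_{xx}k}{k}P_0\Bigr).$$ -/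

import Mathlib

open Set MeasureTheory
open scoped ContDiff

noncomputable section

namespace WhithamKdV

/-! ### Elliptic integrals and the Jacobi function `cn` (all with parameter `m`) -/

/-- Incomplete elliptic integral of the first kind `F(φ; m)`. -/
def ellF (m φ : ℝ) : ℝ := ∫ s in (0 : ℝ)..φ, (√(1 - m * Real.sin s ^ 2))⁻¹

/-- Complete elliptic integral of the first kind `K(m)`. -/
def ellK (m : ℝ) : ℝ := ellF m (Real.pi / 2)

/-- Complete elliptic integral of the second kind `E(m)`. -/
def ellE (m : ℝ) : ℝ := ∫ s in (0 : ℝ)..(Real.pi / 2), √(1 - m * Real.sin s ^ 2)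

/-- Jacobi amplitude `am(z; m)`: the inverse function of `φ ↦ F(φ; m)`,
which is a bijection of `ℝ` for `0 < m < 1`. -/
def jacobiAm (m z : ℝ) : ℝ := Function.invFun (ellF m) z

/-- Jacobi elliptic cosine `cn(z; m)`. -/
def jacobiCn (m z : ℝ) : ℝ := Real.cos (jacobiAm m z)

/-! ### Slow variables as functions of the Riemann variables

The Riemann variables `(r₁, r₂, r₃)` are `(r 0, r 1, r 2)`. -/

/-- Strictly ordered Riemann variables, i.e. `0 < m < 1`. -/
def Ordered (r : Fin 3 → ℝ) : Prop := r 0 < r 1 ∧ r 1 < r 2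

/-- The elliptic parameter `m`. -/
def ellM (r : Fin 3 → ℝ) : ℝ := (r 1 - r 0) / (r 2 - r 0)

/-- The wave number `k`, where `k² = (r₃ - r₁) / (4 K(m)²)`. -/
def waveK (r : Fin 3 → ℝ) : ℝ := √((r 2 - r 0) / (4 * ellK (ellM r) ^ 2))

/-- The phase velocity `V`. -/
def velV (r : Fin 3 → ℝ) : ℝ := 2 * (r 0 + r 1 + r 2)

/-- The first integration constant `C₁`. -/
def constC1 (r : Fin 3 → ℝ) : ℝ :=
  r 0 ^ 2 + r 1 ^ 2 + r 2 ^ 2 - 2 * (r 0 * r 1 + r 1 * r 2 + r 2 * r 0)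

/-- The second integration constant `C₂`. -/
def constC2 (r : Fin 3 → ℝ) : ℝ :=
  2 * (-r 0 ^ 3 - r 1 ^ 3 - r 2 ^ 3 + r 0 ^ 2 * (r 1 + r 2) + r 1 ^ 2 * (r 2 + r 0)
    + r 2 ^ 2 * (r 0 + r 1) - 2 * r 0 * r 1 * r 2)

/-- The leading-order mean `Q₀`. -/
def meanQ0 (r : Fin 3 → ℝ) : ℝ :=
  r 1 - (r 2 - r 0) + 2 * (r 2 - r 0) * (ellE (ellM r) / ellK (ellM r))

/-- The partial derivative `∂k/∂r_j`. -/
def partialK (j : Fin 3) (r : Fin 3 → ℝ) : ℝ :=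
  deriv (fun s => waveK (Function.update r j s)) (r j)

/-- The classical characteristic velocity `v_j = ∂_j(kV) / ∂_j k = V + 2k / ∂_j k`. -/
def charVel (j : Fin 3) (r : Fin 3 → ℝ) : ℝ := velV r + 2 * waveK r / partialK j r

/-- The leading-order cnoidal wave
`u₀(θ) = λ₂ + (λ₃ - λ₂) cn²(2K(m)θ; m)`, `λ₂ = r₁ - r₂ + r₃`, `λ₃ = -r₁ + r₂ + r₃`. -/
def cnoidal (r : Fin 3 → ℝ) (θ : ℝ) : ℝ :=
  (r 0 - r 1 + r 2) + ((-r 0 + r 1 + r 2) - (r 0 - r 1 + r 2)) *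
    jacobiCn (ellM r) (2 * ellK (ellM r) * θ) ^ 2

/-! ### Slow fields: functions of `x` and `t` -/

/-- `∂f/∂x` for `f = f(x, t)`. -/
def dx (f : ℝ → ℝ → ℝ) : ℝ → ℝ → ℝ := fun x t => deriv (fun y => f y t) x

/-- `∂f/∂t` for `f = f(x, t)`. -/
def dt (f : ℝ → ℝ → ℝ) : ℝ → ℝ → ℝ := fun x t => deriv (fun s => f x s) t

/-- `Φ₁ = ∂ₓ(2 Q_xx + (3 k_x / k) Q_x + (k_xx / k) Q)`. -/
def Phi1 (k Q : ℝ → ℝ → ℝ) : ℝ → ℝ → ℝ :=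
  dx fun x t => 2 * dx (dx Q) x t + 3 * dx k x t / k x t * dx Q x t
    + dx (dx k) x t / k x t * Q x t

/-- `Q_d = (3 ∂ₓ(k Q_x) + k_xx Q) / k`. -/
def Qd (k Q : ℝ → ℝ → ℝ) : ℝ → ℝ → ℝ := fun x t =>
  (3 * dx (fun x t => k x t * dx Q x t) x t + dx (dx k) x t * Q x t) / k x t

/-- `Φ₂ = ∂ₜ Q_d + ∂ₓ(V Q_d + P_xx / 2 + (3 k_x / 2k) P_x + (k_xx / k) P)
  - ε² ∂ₓ((k ∂ₓₓ + 3 k_x ∂ₓ + 2 k_xx) Q_d / (2k))`, where `P = V Q + C₁`. -/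
def Phi2 (ε : ℝ) (k V C₁ Q : ℝ → ℝ → ℝ) : ℝ → ℝ → ℝ :=
  let P : ℝ → ℝ → ℝ := fun x t => V x t * Q x t + C₁ x t
  let D : ℝ → ℝ → ℝ := Qd k Q
  fun x t => dt D x t
    + dx (fun x t => V x t * D x t + dx (dx P) x t / 2
        + 3 * dx k x t / (2 * k x t) * dx P x t + dx (dx k) x t / k x t * P x t) x t
    - ε ^ 2 * dx (fun x t => (k x t * dx (dx D) x t + 3 * dx k x t * dx D x t
        + 2 * dx (dx k) x t * D x t) / (2 * k x t)) x t

/-- The all-orders Whitham equations at the point `(x, t)`, for the Riemann variables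
`r = r(x, t)` (through which `k, V, C₁, C₂` are expressed) and the mean `Q = Q(x, t)`. -/
def AllOrdersWhitham (ε : ℝ) (r : ℝ → ℝ → Fin 3 → ℝ) (Q : ℝ → ℝ → ℝ) (x t : ℝ) : Prop :=
  let k : ℝ → ℝ → ℝ := fun x t => waveK (r x t)
  let V : ℝ → ℝ → ℝ := fun x t => velV (r x t)
  let C₁ : ℝ → ℝ → ℝ := fun x t => constC1 (r x t)
  let C₂ : ℝ → ℝ → ℝ := fun x t => constC2 (r x t)
  let P : ℝ → ℝ → ℝ := fun x t => V x t * Q x t + C₁ x t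
  dt k x t + dx (fun x t => k x t * V x t) x t = 0 ∧
  dt Q x t + dx P x t - ε ^ 2 * Phi1 k Q x t = 0 ∧
  dt P x t + dx (fun x t => V x t * P x t - 3 * C₂ x t) x t
    - ε ^ 2 * Phi2 ε k V C₁ Q x t = 0

/-- The classical Whitham-KdV system at the point `(x, t)`. -/
def ClassicalWhitham (r : ℝ → ℝ → Fin 3 → ℝ) (x t : ℝ) : Prop :=
  let k : ℝ → ℝ → ℝ := fun x t => waveK (r x t)
  let V : ℝ → ℝ → ℝ := fun x t => velV (r x t)
  let P : ℝ → ℝ → ℝ := fun x t => V x t * meanQ0 (r x t) + constC1 (r x t)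
  dt k x t + dx (fun x t => k x t * V x t) x t = 0 ∧
  dt (fun x t => meanQ0 (r x t)) x t + dx P x t = 0 ∧
  dt P x t + dx (fun x t => V x t * P x t - 3 * constC2 (r x t)) x t = 0

/-- `X₁ = ∂ₜ q + ∂ₓ(V q) - Φ₁`. -/
def X1 (V q Φ₁ : ℝ → ℝ → ℝ) : ℝ → ℝ → ℝ := fun x t =>
  dt q x t + dx (fun x t => V x t * q x t) x t - Φ₁ x t

/-- `X₂ = ∂ₜ(V q) + ∂ₓ(V² q) - Φ₂`. -/
def X2 (V q Φ₂ : ℝ → ℝ → ℝ) : ℝ → ℝ → ℝ := fun x t =>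
  dt (fun x t => V x t * q x t) x t + dx (fun x t => V x t ^ 2 * q x t) x t - Φ₂ x t

/-- The left-hand side `∂ₜ r_j + v_j ∂ₓ r_j` of the classical system in Riemann form. -/
def riemannLead (r : ℝ → ℝ → Fin 3 → ℝ) (j : Fin 3) (x t : ℝ) : ℝ :=
  dt (fun x t => r x t j) x t + charVel j (r x t) * dx (fun x t => r x t j) x t

/-- The correction
`(X₂ + 6 (r_j - r_l - r_m) X₁) / (24 (r_j - r_l) (r_j - r_m) ∂_j k / k)`,
`{j, l, m} = {1, 2, 3}` (indices are added modulo 3), for given values `a = X₁`, `b = X₂`. -/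
def riemannCorr (r : Fin 3 → ℝ) (a b : ℝ) (j : Fin 3) : ℝ :=
  (b + 6 * (r j - r (j + 1) - r (j + 2)) * a) /
    (24 * (r j - r (j + 1)) * (r j - r (j + 2)) * (partialK j r / waveK r))

/-- The correction term of the `j`-th Whitham equation in Riemann form, without the factor `ε²`:
`riemannCorr` with `X₁, X₂` formed from `q` and from `Φ₁, Φ₂` evaluated at `(ε, Q)`. -/
def riemannCorrField (ε : ℝ) (r : ℝ → ℝ → Fin 3 → ℝ) (q Q : ℝ → ℝ → ℝ)
    (j : Fin 3) (x t : ℝ) : ℝ :=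
  let k : ℝ → ℝ → ℝ := fun x t => waveK (r x t)
  let V : ℝ → ℝ → ℝ := fun x t => velV (r x t)
  let C₁ : ℝ → ℝ → ℝ := fun x t => constC1 (r x t)
  riemannCorr (r x t) (X1 V q (Phi1 k Q) x t) (X2 V q (Phi2 ε k V C₁ Q) x t) j

/-! ### The corrections `u_n` to the cnoidal wave -/

/-- Average over a period in `θ` (the period is `1`; the period cell is `[-1/2, 1/2]`, and for
1-periodic functions any other cell gives the same value). -/
def avg (f : ℝ → ℝ) : ℝ := ∫ θ in (-1 / 2 : ℝ)..(1 / 2), f θ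

/-- The antiderivative of `f - avg f` whose average over a period vanishes. -/
def hatInt (f : ℝ → ℝ) (θ : ℝ) : ℝ :=
  (∫ z in (0 : ℝ)..θ, (f z - avg f)) - avg fun φ => ∫ z in (0 : ℝ)..φ, (f z - avg f)

/-- `lag u j n = u_{n - j}`, read as `0` if `n < j`. -/
def lag (u : ℕ → ℝ → ℝ → ℝ → ℝ) (j n : ℕ) : ℝ → ℝ → ℝ → ℝ :=
  if j ≤ n then u (n - j) else fun _ _ _ => 0

/-- `F_{n+1}(θ, x, t)`, the forcing that the terms `u_0, …, u_n` of `u = u₀ + ε u₁ + ε² u₂ + ⋯`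
produce at order `ε^{n+1}` in the once integrated KdV equation
`k² u'' + 3 u² - V u + ε F = C₁`, where `k F = ∂ₜ Ĵ₁ + 3 ∂ₓ Ĵ₂ + 3 k ∂ₓ(k u')
  + ε (3 k u_xx + 3 k_x u_x + k_xx u) + ε² ∂ₓₓₓ Ĵ₁` and `Ĵ_i` is the zero-average
antiderivative in `θ` of `u^i` minus its average. -/
def forcing (k : ℝ → ℝ → ℝ) (u : ℕ → ℝ → ℝ → ℝ → ℝ) (n : ℕ) (θ x t : ℝ) : ℝ :=
  3 * ∑ i ∈ Finset.Ico 1 (n + 1), u i θ x t * u (n + 1 - i) θ x t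
  + (dt (fun x t => hatInt (fun z => u n z x t) θ) x t
    + 3 * dx (fun x t => hatInt
        (fun z => ∑ i ∈ Finset.range (n + 1), u i z x t * u (n - i) z x t) θ) x t
    + 3 * k x t * dx (fun x t => k x t * deriv (fun z => u n z x t) θ) x t
    + (3 * k x t * dx (dx (lag u 1 n θ)) x t + 3 * dx k x t * dx (lag u 1 n θ) x t
        + dx (dx k) x t * lag u 1 n θ x t)
    + dx (dx (dx fun x t => hatInt (fun z => lag u 2 n z x t) θ)) x t) / k x t

/-- `u_0, u_1, u_2, …` (functions of `θ, x, t`) are the terms of the expansion of the KdV solution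
over the slow variables `r(x, t)`, `(x, t) ∈ Ω`: `u_0` is the cnoidal wave, and the corrections
solve `k² u_n'' + (6 u₀ - V) u_n + F_n = 0` with the phase fixed by `u_n' = 0` at `θ = 0`,
and with `u_n = 0` at `θ = 0`. The last condition is only imposed for odd `n`, so that for even `n`
an arbitrary (slow) multiple of the even homogeneous solution may be added. -/
structure IsCorrectionHierarchy (Ω : Set (ℝ × ℝ)) (r : ℝ → ℝ → Fin 3 → ℝ)
    (u : ℕ → ℝ → ℝ → ℝ → ℝ) : Prop where
  smooth : ∀ n, ContDiffOn ℝ ∞ (fun p : ℝ × ℝ × ℝ => u n p.1 p.2.1 p.2.2) (univ ×ˢ Ω)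
  lead : ∀ x t, (x, t) ∈ Ω → ∀ θ, u 0 θ x t = cnoidal (r x t) θ
  ode : ∀ n x t, (x, t) ∈ Ω → ∀ θ,
    waveK (r x t) ^ 2 * deriv (deriv fun z => u (n + 1) z x t) θ
      + (6 * u 0 θ x t - velV (r x t)) * u (n + 1) θ x t
      + forcing (fun x t => waveK (r x t)) u n θ x t = 0
  deriv_zero : ∀ n x t, (x, t) ∈ Ω → deriv (fun z => u (n + 1) z x t) 0 = 0
  odd_zero : ∀ n x t, (x, t) ∈ Ω → u (2 * n + 1) 0 x t = 0

end WhithamKdV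

end

/-!
The argument rests on one closed formula. From the derivatives of the complete elliptic integrals
(`hasDerivAt_ellK`, `hasDerivAt_ellE`) one finds, with `{j, l, m} = {1, 2, 3}`,

  `∂_j k / k = (Q₀ + r_j - r_l - r_m) / (4 (r_j - r_l) (r_j - r_m))`,
  `∂_j Q₀ = (∂_j k / k) (Q₀ + r_j - r_l - r_m)`

(`hasDerivAt_waveK_comp`, `hasDerivAt_meanQ0_comp`). The numerators are multiples of `E - K`,
`E - (1 - m) K` and `E`, so they do not vanish (`logDerivK_ne_zero`). With
`S_j = (∂_j k / k) (∂ₜ r_j + v_j ∂ₓ r_j)` these formulas say that the left-hand sides of the three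
classical equations are `k ∑ S_j`, `∑ (Q₀ + r_j - r_l - r_m) S_j` and `∑ (P₀ - (3/2) ∂_j C₂) S_j`.
The weights are polynomials in `r_j` of degrees 0, 1 and 2, up to symmetric functions of the `r`, so
the system is of Vandermonde type and Lagrange interpolation inverts it (`riemann_system_iff`). The
all-orders equations are the same system with right-hand sides `-ε² X₁`, `-ε² X₂` in the last two
equations (`allOrdersWhitham_iff`).

The corrections `u_n` have the parity of `n` by induction (`IsCorrectionHierarchy.parity`): the
forcing `F_n` inherits it (`forcing_neg`), and `u_n(-θ)` and `(-1)^n u_n(θ)` solve the same linear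
second-order equation with the same data at `θ = 0`. Hence the odd corrections have zero mean, and
the mean of `u` contains only even powers of `ε`.

For the last claim, let `δ` replace `ε²` throughout the correction term, with `Q = Q₀ + δ (q₂ + δ W)`
and `W` the mean of the remainder `w` (`corrFamily`). The result is smooth in `(δ, ε, x, t)` jointly,
because means and complete elliptic integrals depend smoothly on parameters
(`contDiffOn_infty_intervalIntegral`). It is the full correction at `δ = ε²` and the leading-order
one at `δ = 0`, so the two differ by `O(ε²)` on compact sets (`SmoothFamily.exists_bound`).
-/

namespace WhithamKdV

open Filter Topology

/-! ### Integrals depending smoothly on parameters -/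

theorem hasFDerivAt_intervalIntegral_of_contDiffOn {H E : Type} [NormedAddCommGroup H]
    [NormedSpace ℝ H] [NormedAddCommGroup E] [NormedSpace ℝ E] {U : Set H} (hU : IsOpen U)
    {f : H × ℝ → E} (hf : ContDiffOn ℝ ∞ f (U ×ˢ univ)) (a b : ℝ) {x₀ : H} (hx₀ : x₀ ∈ U) :
    HasFDerivAt (fun x => ∫ t in a..b, f (x, t))
      (∫ t in a..b, (fderiv ℝ f (x₀, t)).comp (ContinuousLinearMap.inl ℝ H ℝ)) x₀ := by
  have hO : IsOpen (U ×ˢ (univ : Set ℝ)) := hU.prod isOpen_univ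
  have hcont : ContinuousOn f (U ×ˢ univ) := hf.continuousOn
  have hcont' : ContinuousOn (fderiv ℝ f) (U ×ˢ univ) :=
    hf.continuousOn_fderiv_of_isOpen hO (by simp)
  have hslice : ∀ x ∈ U, Continuous fun t => f (x, t) := fun x hx =>
    hcont.comp_continuous (by fun_prop) (fun t => ⟨hx, mem_univ t⟩)
  have hcF : ContinuousOn (fun p : H × ℝ =>
      (fderiv ℝ f p).comp (ContinuousLinearMap.inl ℝ H ℝ)) (U ×ˢ univ) :=
    hcont'.clm_comp continuousOn_const
  have hslice' : Continuous fun t : ℝ =>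
      (fderiv ℝ f (x₀, t)).comp (ContinuousLinearMap.inl ℝ H ℝ) :=
    hcF.comp_continuous (f := fun t : ℝ => (x₀, t)) (by fun_prop) (fun t => ⟨hx₀, mem_univ t⟩)
  obtain ⟨M, hM⟩ := (isCompact_uIcc (a := a) (b := b)).exists_bound_of_continuousOn
    hslice'.continuousOn
  -- a uniform bound near `x₀`, from compactness of the segment of integration
  have hev : ∀ᶠ x in 𝓝 x₀, ∀ t ∈ uIcc a b, x ∈ U ∧
      ‖(fderiv ℝ f (x, t)).comp (ContinuousLinearMap.inl ℝ H ℝ)‖ ≤ M + 1 := by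
    refine isCompact_uIcc.eventually_forall_of_forall_eventually fun t ht => ?_
    have hmem : (x₀, t) ∈ U ×ˢ (univ : Set ℝ) := ⟨hx₀, mem_univ t⟩
    have h1 := ((hcF.continuousAt (hO.mem_nhds hmem)).norm).eventually_lt_const
      (lt_of_le_of_lt (hM t ht) (lt_add_one M))
    filter_upwards [h1, hO.mem_nhds hmem] with p hp hpU
    exact ⟨hpU.1, hp.le⟩
  refine intervalIntegral.hasFDerivAt_integral_of_dominated_of_fderiv_le (μ := volume) (𝕜 := ℝ)
    (F := fun x t => f (x, t))
    (F' := fun x t => (fderiv ℝ f (x, t)).comp (ContinuousLinearMap.inl ℝ H ℝ))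
    (bound := fun _ => M + 1) hev ?_ ?_ ?_ ?_ ?_ ?_
  · filter_upwards [hU.mem_nhds hx₀] with x hx
    exact (hslice x hx).aestronglyMeasurable
  · exact (hslice x₀ hx₀).intervalIntegrable a b
  · exact hslice'.aestronglyMeasurable
  · exact Eventually.of_forall fun t ht x hx => (hx t (uIoc_subset_uIcc ht)).2
  · exact intervalIntegrable_const
  · refine Eventually.of_forall fun t ht x hx => ?_
    have hxU := (hx t (uIoc_subset_uIcc ht)).1
    have h2 : HasFDerivAt f (fderiv ℝ f (x, t)) (x, t) :=
      ((hf.contDiffAt (hO.mem_nhds ⟨hxU, mem_univ t⟩)).differentiableAt (by simp)).hasFDerivAt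
    exact h2.comp x (hasFDerivAt_prodMk_left x t)

/-- Integrals of smooth functions over a fixed segment are smooth in the parameters; the derivative
is again such an integral, so the orders of differentiability are gained one by one. -/
theorem contDiffOn_intervalIntegral {H : Type} [NormedAddCommGroup H]
    [NormedSpace ℝ H] {U : Set H} (hU : IsOpen U) (a b : ℝ) (n : ℕ) :
    ∀ {E : Type} [NormedAddCommGroup E] [NormedSpace ℝ E] {f : H × ℝ → E},
      ContDiffOn ℝ ∞ f (U ×ˢ univ) → ContDiffOn ℝ n (fun x => ∫ t in a..b, f (x, t)) U := by
  have hO : IsOpen (U ×ˢ (univ : Set ℝ)) := hU.prod isOpen_univ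
  induction n with
  | zero =>
    intro E _ _ f hf
    exact contDiffOn_zero.2 fun x hx =>
      (hasFDerivAt_intervalIntegral_of_contDiffOn hU hf a b hx).continuousAt.continuousWithinAt
  | succ n ih =>
    intro E _ _ f hf
    have hd := fun x hx => hasFDerivAt_intervalIntegral_of_contDiffOn hU hf a b (x₀ := x) hx
    rw [Nat.cast_succ, contDiffOn_succ_iff_fderiv_of_isOpen hU]
    refine ⟨fun x hx => (hd x hx).differentiableAt.differentiableWithinAt, by simp, ?_⟩
    refine (ih (f := fun p => (fderiv ℝ f p).comp (ContinuousLinearMap.inl ℝ H ℝ)) ?_).congr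
      fun x hx => (hd x hx).fderiv
    exact (hf.fderiv_of_isOpen hO (by simp)).clm_comp contDiffOn_const

theorem contDiffOn_infty_intervalIntegral {H E : Type} [NormedAddCommGroup H]
    [NormedSpace ℝ H] [NormedAddCommGroup E] [NormedSpace ℝ E] {U : Set H} (hU : IsOpen U)
    {f : H × ℝ → E} (hf : ContDiffOn ℝ ∞ f (U ×ˢ univ)) (a b : ℝ) :
    ContDiffOn ℝ ∞ (fun x => ∫ t in a..b, f (x, t)) U :=
  contDiffOn_infty.2 fun n => contDiffOn_intervalIntegral hU a b n hf

/-! ### Complete elliptic integrals -/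

theorem hasDerivAt_intervalIntegral_of_contDiffOn {U : Set ℝ} (hU : IsOpen U)
    {f : ℝ × ℝ → ℝ} (hf : ContDiffOn ℝ ∞ f (U ×ˢ univ)) (a b : ℝ) {x₀ : ℝ} (hx₀ : x₀ ∈ U)
    {f' : ℝ → ℝ} (hf' : ∀ t, HasDerivAt (fun x => f (x, t)) (f' t) x₀) :
    HasDerivAt (fun x => ∫ t in a..b, f (x, t)) (∫ t in a..b, f' t) x₀ := by
  have hO : IsOpen (U ×ˢ (univ : Set ℝ)) := hU.prod isOpen_univ
  have h := (hasFDerivAt_intervalIntegral_of_contDiffOn hU hf a b hx₀).hasDerivAt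
  have hcont : Continuous fun t : ℝ =>
      (fderiv ℝ f (x₀, t)).comp (ContinuousLinearMap.inl ℝ ℝ ℝ) :=
    ((hf.continuousOn_fderiv_of_isOpen hO (by simp)).comp_continuous
      (f := fun t : ℝ => (x₀, t)) (by fun_prop) (fun t => ⟨hx₀, mem_univ t⟩)).clm_comp
      continuous_const
  rw [ContinuousLinearMap.intervalIntegral_apply (𝕜 := ℝ) (hcont.intervalIntegrable a b)] at h
  refine h.congr_deriv (intervalIntegral.integral_congr fun t _ => ?_)
  have h2 : HasFDerivAt f (fderiv ℝ f (x₀, t)) (x₀, t) :=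
    ((hf.contDiffAt (hO.mem_nhds ⟨hx₀, mem_univ t⟩)).differentiableAt (by simp)).hasFDerivAt
  exact (h2.comp x₀ (hasFDerivAt_prodMk_left x₀ t)).hasDerivAt.unique (hf' t)

theorem one_sub_mul_sin_sq_pos {m : ℝ} (hm : m < 1) (s : ℝ) : 0 < 1 - m * Real.sin s ^ 2 := by
  have h := Real.sin_sq_add_cos_sq s
  rcases le_or_gt m 0 with h0 | h0
  · nlinarith [sq_nonneg (Real.sin s)]
  · nlinarith [sq_nonneg (Real.cos s)]

theorem sqrt_one_sub_pos {m : ℝ} (hm : m < 1) (s : ℝ) : 0 < √(1 - m * Real.sin s ^ 2) :=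
  Real.sqrt_pos.2 (one_sub_mul_sin_sq_pos hm s)

theorem continuous_sqrt_one_sub (m : ℝ) : Continuous fun s => √(1 - m * Real.sin s ^ 2) := by
  fun_prop

theorem continuous_inv_sqrt_one_sub {m : ℝ} (hm : m < 1) :
    Continuous fun s => (√(1 - m * Real.sin s ^ 2))⁻¹ :=
  (continuous_sqrt_one_sub m).inv₀ fun s => (sqrt_one_sub_pos hm s).ne'

theorem contDiffOn_sqrt_one_sub :
    ContDiffOn ℝ ∞ (fun p : ℝ × ℝ => √(1 - p.1 * Real.sin p.2 ^ 2)) (Iio 1 ×ˢ univ) :=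
  ContDiffOn.sqrt (ContDiff.contDiffOn (by fun_prop))
    fun p hp => (one_sub_mul_sin_sq_pos hp.1 p.2).ne'

theorem contDiffOn_inv_sqrt_one_sub :
    ContDiffOn ℝ ∞ (fun p : ℝ × ℝ => (√(1 - p.1 * Real.sin p.2 ^ 2))⁻¹) (Iio 1 ×ˢ univ) :=
  contDiffOn_sqrt_one_sub.inv fun p hp => (sqrt_one_sub_pos hp.1 p.2).ne'

theorem contDiffOn_ellK : ContDiffOn ℝ ∞ ellK (Iio 1) :=
  contDiffOn_infty_intervalIntegral isOpen_Iio contDiffOn_inv_sqrt_one_sub 0 (Real.pi / 2)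

theorem contDiffOn_ellE : ContDiffOn ℝ ∞ ellE (Iio 1) :=
  contDiffOn_infty_intervalIntegral isOpen_Iio contDiffOn_sqrt_one_sub 0 (Real.pi / 2)

theorem hasDerivAt_sqrt_one_sub_modulus {m : ℝ} (hm : m < 1) (s : ℝ) :
    HasDerivAt (fun m => √(1 - m * Real.sin s ^ 2))
      (-(Real.sin s ^ 2) / (2 * √(1 - m * Real.sin s ^ 2))) m := by
  have h : HasDerivAt (fun m => 1 - m * Real.sin s ^ 2) (-(Real.sin s ^ 2)) m := by
    simpa using ((hasDerivAt_id m).mul_const (Real.sin s ^ 2)).const_sub 1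
  exact h.sqrt (one_sub_mul_sin_sq_pos hm s).ne'

theorem hasDerivAt_ellE {m : ℝ} (h0 : m ≠ 0) (hm : m < 1) :
    HasDerivAt ellE ((ellE m - ellK m) / (2 * m)) m := by
  have h := hasDerivAt_intervalIntegral_of_contDiffOn isOpen_Iio contDiffOn_sqrt_one_sub 0
    (Real.pi / 2) hm (fun t => hasDerivAt_sqrt_one_sub_modulus hm t)
  refine HasDerivAt.congr_deriv (f := ellE) h (Eq.symm ?_)
  rw [ellE, ellK, ellF, ← intervalIntegral.integral_sub
    ((continuous_sqrt_one_sub m).intervalIntegrable _ _)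
    ((continuous_inv_sqrt_one_sub hm).intervalIntegrable _ _),
    ← intervalIntegral.integral_div]
  refine intervalIntegral.integral_congr fun s _ => ?_
  have hp := sqrt_one_sub_pos hm s
  have hsq := Real.sq_sqrt (one_sub_mul_sin_sq_pos hm s).le
  generalize √(1 - m * Real.sin s ^ 2) = d at *
  field_simp
  linear_combination hsq

theorem hasDerivAt_sin_mul_cos_div {m : ℝ} (hm : m < 1) (s : ℝ) :
    HasDerivAt (fun s => Real.sin s * Real.cos s / √(1 - m * Real.sin s ^ 2))
      (((Real.cos s ^ 2 - Real.sin s ^ 2) * √(1 - m * Real.sin s ^ 2) ^ 2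
        + m * Real.sin s ^ 2 * Real.cos s ^ 2) / √(1 - m * Real.sin s ^ 2) ^ 3) s := by
  have hp := sqrt_one_sub_pos hm s
  have h1 : HasDerivAt (fun s => 1 - m * Real.sin s ^ 2)
      (-(m * (2 * Real.sin s * Real.cos s))) s := by
    have := (((Real.hasDerivAt_sin s).pow 2).const_mul m).const_sub 1
    simpa using this
  have h2 := ((Real.hasDerivAt_sin s).mul (Real.hasDerivAt_cos s)).div
    (h1.sqrt (one_sub_mul_sin_sq_pos hm s).ne') hp.ne'
  refine h2.congr_deriv ?_
  simp only [Pi.mul_apply]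
  field_simp
  ring

/-- The derivative of `K`. The integrand `sin² / (2Δ³)`, `Δ² = 1 - m sin²`, differs from a
combination of `Δ` and `1/Δ` by the derivative of `sin cos / Δ`, which vanishes at both ends. -/
theorem hasDerivAt_ellK {m : ℝ} (h0 : m ≠ 0) (hm : m < 1) :
    HasDerivAt ellK ((ellE m - (1 - m) * ellK m) / (2 * m * (1 - m))) m := by
  have h1m : 1 - m ≠ 0 := by linarith
  have h := hasDerivAt_intervalIntegral_of_contDiffOn isOpen_Iio contDiffOn_inv_sqrt_one_sub 0
    (Real.pi / 2) hm
    (fun t => (hasDerivAt_sqrt_one_sub_modulus hm t).inv (sqrt_one_sub_pos hm t).ne')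
  have hbd : ∫ s in (0 : ℝ)..(Real.pi / 2),
      (((Real.cos s ^ 2 - Real.sin s ^ 2) * √(1 - m * Real.sin s ^ 2) ^ 2
        + m * Real.sin s ^ 2 * Real.cos s ^ 2) / √(1 - m * Real.sin s ^ 2) ^ 3) = 0 := by
    rw [intervalIntegral.integral_eq_sub_of_hasDerivAt
      (fun s _ => hasDerivAt_sin_mul_cos_div hm s)]
    · simp
    · refine Continuous.intervalIntegrable ?_ _ _
      exact Continuous.div (by fun_prop) (by fun_prop)
        fun s => (pow_pos (sqrt_one_sub_pos hm s) 3).ne'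
  have hci : Continuous fun s => ((Real.cos s ^ 2 - Real.sin s ^ 2)
      * √(1 - m * Real.sin s ^ 2) ^ 2 + m * Real.sin s ^ 2 * Real.cos s ^ 2)
      / √(1 - m * Real.sin s ^ 2) ^ 3 :=
    Continuous.div (by fun_prop) (by fun_prop) fun s => (pow_pos (sqrt_one_sub_pos hm s) 3).ne'
  refine HasDerivAt.congr_deriv (f := ellK) h (Eq.symm ?_)
  have hE : ellE m = ∫ s in (0 : ℝ)..(Real.pi / 2), (√(1 - m * Real.sin s ^ 2)
      - m * (((Real.cos s ^ 2 - Real.sin s ^ 2) * √(1 - m * Real.sin s ^ 2) ^ 2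
        + m * Real.sin s ^ 2 * Real.cos s ^ 2) / √(1 - m * Real.sin s ^ 2) ^ 3)) := by
    rw [intervalIntegral.integral_sub ((continuous_sqrt_one_sub m).intervalIntegrable _ _)
      ((hci.const_mul m).intervalIntegrable _ _), intervalIntegral.integral_const_mul, hbd, ellE]
    ring
  rw [hE, ellK, ellF, ← intervalIntegral.integral_const_mul, ← intervalIntegral.integral_sub
    (Continuous.intervalIntegrable (by fun_prop) _ _)
    (((continuous_inv_sqrt_one_sub hm).const_mul _).intervalIntegrable _ _),
    ← intervalIntegral.integral_div]
  refine intervalIntegral.integral_congr fun s _ => ?_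
  have hp := sqrt_one_sub_pos hm s
  have hsq := Real.sq_sqrt (one_sub_mul_sin_sq_pos hm s).le
  rw [Real.cos_sq']
  generalize √(1 - m * Real.sin s ^ 2) = d at *
  field_simp
  have h4 : d ^ 4 = (1 - m * Real.sin s ^ 2) ^ 2 := by rw [← hsq]; ring
  ring_nf
  ring_nf at h4 hsq
  rw [h4, hsq]
  ring

theorem ellK_pos {m : ℝ} (hm : m < 1) : 0 < ellK m :=
  intervalIntegral.intervalIntegral_pos_of_pos
    ((continuous_inv_sqrt_one_sub hm).intervalIntegrable _ _)
    (fun s => inv_pos.2 (sqrt_one_sub_pos hm s)) (by positivity)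

theorem ellE_pos {m : ℝ} (hm : m < 1) : 0 < ellE m :=
  intervalIntegral.intervalIntegral_pos_of_pos
    ((continuous_sqrt_one_sub m).intervalIntegrable _ _)
    (fun s => sqrt_one_sub_pos hm s) (by positivity)

theorem ellE_lt_ellK {m : ℝ} (h0 : 0 < m) (hm : m < 1) : ellE m < ellK m := by
  rw [← sub_pos, ellE, ellK, ellF, ← intervalIntegral.integral_sub
    ((continuous_inv_sqrt_one_sub hm).intervalIntegrable _ _)
    ((continuous_sqrt_one_sub m).intervalIntegrable _ _)]
  refine intervalIntegral.intervalIntegral_pos_of_pos_on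
    (((continuous_inv_sqrt_one_sub hm).sub (continuous_sqrt_one_sub m)).intervalIntegrable _ _)
    (fun s hs => ?_) (by positivity)
  have hp := sqrt_one_sub_pos hm s
  have hsq := Real.sq_sqrt (one_sub_mul_sin_sq_pos hm s).le
  have hsin : 0 < Real.sin s := Real.sin_pos_of_pos_of_lt_pi hs.1 (by linarith [hs.2, Real.pi_pos])
  have : (√(1 - m * Real.sin s ^ 2))⁻¹ - √(1 - m * Real.sin s ^ 2)
      = m * Real.sin s ^ 2 / √(1 - m * Real.sin s ^ 2) := by
    field_simp
    linear_combination -hsq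
  rw [this]
  positivity

/-- This integral gives both the mean of `cn²` and, being positive, `(1 - m) K < E`. -/
theorem integral_cos_sq_div_sqrt {m : ℝ} (h0 : m ≠ 0) (hm : m < 1) :
    ∫ s in (0 : ℝ)..(Real.pi / 2), Real.cos s ^ 2 * (√(1 - m * Real.sin s ^ 2))⁻¹
      = (ellE m - (1 - m) * ellK m) / m := by
  rw [ellE, ellK, ellF, ← intervalIntegral.integral_const_mul, ← intervalIntegral.integral_sub
    ((continuous_sqrt_one_sub m).intervalIntegrable _ _)
    (((continuous_inv_sqrt_one_sub hm).const_mul _).intervalIntegrable _ _),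
    ← intervalIntegral.integral_div]
  refine intervalIntegral.integral_congr fun s _ => ?_
  have hp := sqrt_one_sub_pos hm s
  have hsq := Real.sq_sqrt (one_sub_mul_sin_sq_pos hm s).le
  rw [Real.cos_sq']
  generalize √(1 - m * Real.sin s ^ 2) = d at *
  field_simp
  linear_combination -hsq

theorem one_sub_mul_ellK_lt_ellE {m : ℝ} (h0 : 0 < m) (hm : m < 1) :
    (1 - m) * ellK m < ellE m := by
  have h : 0 < ∫ s in (0 : ℝ)..(Real.pi / 2),
      Real.cos s ^ 2 * (√(1 - m * Real.sin s ^ 2))⁻¹ := by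
    refine intervalIntegral.intervalIntegral_pos_of_pos_on
      (((Real.continuous_cos.pow 2).mul (continuous_inv_sqrt_one_sub hm)).intervalIntegrable _ _)
      (fun s hs => ?_) (by positivity)
    have hp := sqrt_one_sub_pos hm s
    have hcos : 0 < Real.cos s := Real.cos_pos_of_mem_Ioo ⟨by linarith [hs.1, Real.pi_pos], hs.2⟩
    positivity
  rw [integral_cos_sq_div_sqrt h0.ne' hm] at h
  have := (div_pos_iff_of_pos_right h0).1 h
  linarith

/-! ### Derivatives of the wave number and of the mean of the cnoidal wave -/

theorem Ordered.sub_pos {r : Fin 3 → ℝ} (h : Ordered r) : 0 < r 2 - r 0 := by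
  linarith [h.1, h.2]

theorem Ordered.ellM_pos {r : Fin 3 → ℝ} (h : Ordered r) : 0 < ellM r :=
  div_pos (by linarith [h.1]) h.sub_pos

theorem Ordered.ellM_lt_one {r : Fin 3 → ℝ} (h : Ordered r) : ellM r < 1 :=
  (div_lt_one h.sub_pos).2 (by linarith [h.2])

theorem isOpen_ordered : IsOpen {r : Fin 3 → ℝ | Ordered r} :=
  (isOpen_lt (continuous_apply 0) (continuous_apply 1)).inter
    (isOpen_lt (continuous_apply 1) (continuous_apply 2))

theorem Ordered.sub_ne_zero {r : Fin 3 → ℝ} (h : Ordered r) (j : Fin 3) :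
    r j - r (j + 1) ≠ 0 ∧ r j - r (j + 2) ≠ 0 := by
  have h1 := h.1
  have h2 := h.2
  have e1 : (1 : Fin 3) + 1 = 2 := rfl
  have e2 : (1 : Fin 3) + 2 = 0 := rfl
  have e3 : (2 : Fin 3) + 1 = 0 := rfl
  have e4 : (2 : Fin 3) + 2 = 1 := rfl
  fin_cases j <;> simp only [Fin.zero_eta, Fin.mk_one, Fin.reduceFinMk, zero_add, e1, e2, e3, e4]
    <;> constructor <;> intro h <;> linarith

theorem waveK_radicand_pos {r : Fin 3 → ℝ} (h : Ordered r) :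
    0 < (r 2 - r 0) / (4 * ellK (ellM r) ^ 2) := by
  have := ellK_pos h.ellM_lt_one
  have := h.sub_pos
  positivity

theorem waveK_pos {r : Fin 3 → ℝ} (h : Ordered r) : 0 < waveK r :=
  Real.sqrt_pos.2 (waveK_radicand_pos h)

theorem contDiffOn_ellM : ContDiffOn ℝ ∞ ellM {r | Ordered r} :=
  ContDiffOn.div (ContDiff.contDiffOn (by fun_prop)) (ContDiff.contDiffOn (by fun_prop))
    fun _ h => (Ordered.sub_pos h).ne'

theorem contDiffOn_ellK_ellM : ContDiffOn ℝ ∞ (fun r => ellK (ellM r)) {r | Ordered r} :=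
  contDiffOn_ellK.comp contDiffOn_ellM fun _ h => Ordered.ellM_lt_one h

theorem contDiffOn_ellE_ellM : ContDiffOn ℝ ∞ (fun r => ellE (ellM r)) {r | Ordered r} :=
  contDiffOn_ellE.comp contDiffOn_ellM fun _ h => Ordered.ellM_lt_one h

theorem contDiffOn_waveK : ContDiffOn ℝ ∞ waveK {r | Ordered r} := by
  refine ContDiffOn.sqrt (ContDiffOn.div (ContDiff.contDiffOn (by fun_prop))
    (contDiffOn_const.mul (contDiffOn_ellK_ellM.pow 2)) fun r h => ?_)
    fun r h => (waveK_radicand_pos h).ne'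
  have := ellK_pos (Ordered.ellM_lt_one h)
  positivity

theorem contDiffOn_meanQ0 : ContDiffOn ℝ ∞ meanQ0 {r | Ordered r} :=
  ContDiffOn.add (ContDiff.contDiffOn (by fun_prop))
    ((ContDiff.contDiffOn (by fun_prop)).mul (contDiffOn_ellE_ellM.div contDiffOn_ellK_ellM
      fun _ h => (ellK_pos (Ordered.ellM_lt_one h)).ne'))

/-- The logarithmic derivative `∂_j k / k`, in the closed form
`(Q₀ + r_j - r_l - r_m) / (4 (r_j - r_l) (r_j - r_m))`. -/
noncomputable def logDerivK (j : Fin 3) (r : Fin 3 → ℝ) : ℝ :=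
  (meanQ0 r + (r j - r (j + 1) - r (j + 2))) / (4 * (r j - r (j + 1)) * (r j - r (j + 2)))

theorem logDerivK_zero (r : Fin 3 → ℝ) : logDerivK 0 r =
    (meanQ0 r + (r 0 - r 1 - r 2)) / (4 * (r 0 - r 1) * (r 0 - r 2)) := rfl

theorem logDerivK_one (r : Fin 3 → ℝ) : logDerivK 1 r =
    (meanQ0 r + (r 1 - r 2 - r 0)) / (4 * (r 1 - r 2) * (r 1 - r 0)) := rfl

theorem logDerivK_two (r : Fin 3 → ℝ) : logDerivK 2 r =
    (meanQ0 r + (r 2 - r 0 - r 1)) / (4 * (r 2 - r 0) * (r 2 - r 1)) := rfl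

theorem contDiffOn_logDerivK (j : Fin 3) : ContDiffOn ℝ ∞ (logDerivK j) {r | Ordered r} :=
  ContDiffOn.div (contDiffOn_meanQ0.add (ContDiff.contDiffOn (by fun_prop)))
    (ContDiff.contDiffOn (by fun_prop)) fun r h => by
      have := Ordered.sub_ne_zero h j
      simp [this]

theorem hasDerivAt_ellM_comp {ρ : ℝ → Fin 3 → ℝ} {ρ' : Fin 3 → ℝ} {s : ℝ}
    (hρ : HasDerivAt ρ ρ' s) (h : Ordered (ρ s)) :
    HasDerivAt (fun s => ellM (ρ s)) (((ρ' 1 - ρ' 0) * (ρ s 2 - ρ s 0)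
      - (ρ s 1 - ρ s 0) * (ρ' 2 - ρ' 0)) / (ρ s 2 - ρ s 0) ^ 2) s := by
  have hc := hasDerivAt_pi.1 hρ
  exact ((hc 1).sub (hc 0)).div ((hc 2).sub (hc 0)) h.sub_pos.ne'

/-- The wave number along a curve of Riemann variables, with the closed form of `∂_j k / k`. -/
theorem hasDerivAt_waveK_comp {ρ : ℝ → Fin 3 → ℝ} {ρ' : Fin 3 → ℝ} {s : ℝ}
    (hρ : HasDerivAt ρ ρ' s) (h : Ordered (ρ s)) :
    HasDerivAt (fun s => waveK (ρ s))
      (waveK (ρ s) * ∑ j, logDerivK j (ρ s) * ρ' j) s := by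
  have hc := hasDerivAt_pi.1 hρ
  have hK := ellK_pos h.ellM_lt_one
  have hD := h.sub_pos
  have h1 := h.1
  have h2 := h.2
  have hK' := (hasDerivAt_ellK h.ellM_pos.ne' h.ellM_lt_one).comp s (hasDerivAt_ellM_comp hρ h)
  have hk := ((((hc 2).sub (hc 0)).div ((hK'.pow 2).const_mul 4)
    (by change 4 * ellK (ellM (ρ s)) ^ 2 ≠ 0; positivity)).sqrt (waveK_radicand_pos h).ne')
  refine hk.congr_deriv ?_
  have hkpos := waveK_pos h
  have hsq := Real.sq_sqrt (waveK_radicand_pos h).le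
  -- eliminate the square root: only `k ^ 2` remains after multiplication by `2 k`
  change waveK (ρ s) ^ 2 = _ at hsq
  change _ / (2 * waveK (ρ s)) = _
  rw [div_eq_iff (by positivity)]
  have e : ∀ a b : ℝ, a * b * (2 * a) = a ^ 2 * (2 * b) := fun a b => by ring
  rw [e, hsq, Fin.sum_univ_three, logDerivK_zero, logDerivK_one, logDerivK_two, meanQ0]
  simp only [Function.comp, Pi.pow_apply, Pi.sub_apply]
  have hm : 1 - ellM (ρ s) = (ρ s 2 - ρ s 1) / (ρ s 2 - ρ s 0) := by
    rw [ellM]; field_simp; ring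
  rw [hm]
  generalize ellK (ellM (ρ s)) = K at *
  generalize ellE (ellM (ρ s)) = E at *
  rw [ellM]
  generalize ρ s 0 = a at *
  generalize ρ s 1 = b at *
  generalize ρ s 2 = c at *
  have n1 : a - b ≠ 0 := by intro; linarith
  have n2 : b - a ≠ 0 := by intro; linarith
  have n3 : b - c ≠ 0 := by intro; linarith
  have n4 : c - b ≠ 0 := by intro; linarith
  have n5 : a - c ≠ 0 := by intro; linarith
  have n6 := hD.ne'
  rw [← neg_sub b a, ← neg_sub c b, ← neg_sub c a]
  field_simp
  ring

/-- The mean along a curve of Riemann variables: `∂_j Q₀ = (∂_j k / k) (Q₀ + r_j - r_l - r_m)`,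
that is, `∂_j (V Q₀ + C₁) = v_j ∂_j Q₀`. -/
theorem hasDerivAt_meanQ0_comp {ρ : ℝ → Fin 3 → ℝ} {ρ' : Fin 3 → ℝ} {s : ℝ}
    (hρ : HasDerivAt ρ ρ' s) (h : Ordered (ρ s)) :
    HasDerivAt (fun s => meanQ0 (ρ s)) (∑ j, logDerivK j (ρ s)
      * (meanQ0 (ρ s) + (ρ s j - ρ s (j + 1) - ρ s (j + 2))) * ρ' j) s := by
  have hc := hasDerivAt_pi.1 hρ
  have hK := ellK_pos h.ellM_lt_one
  have hD := h.sub_pos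
  have h1 := h.1
  have h2 := h.2
  have hK' := (hasDerivAt_ellK h.ellM_pos.ne' h.ellM_lt_one).comp s (hasDerivAt_ellM_comp hρ h)
  have hE' := (hasDerivAt_ellE h.ellM_pos.ne' h.ellM_lt_one).comp s (hasDerivAt_ellM_comp hρ h)
  have hQ := ((hc 1).sub ((hc 2).sub (hc 0))).add
    ((((hc 2).sub (hc 0)).const_mul 2).mul (hE'.div hK' hK.ne'))
  refine hQ.congr_deriv ?_
  have e1 : (1 : Fin 3) + 1 = 2 := rfl
  have e2 : (1 : Fin 3) + 2 = 0 := rfl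
  have e3 : (2 : Fin 3) + 1 = 0 := rfl
  have e4 : (2 : Fin 3) + 2 = 1 := rfl
  rw [Fin.sum_univ_three, logDerivK_zero, logDerivK_one, logDerivK_two, meanQ0]
  simp only [Function.comp, Pi.sub_apply, Pi.div_apply, zero_add, e1, e2, e3, e4]
  have hm : 1 - ellM (ρ s) = (ρ s 2 - ρ s 1) / (ρ s 2 - ρ s 0) := by
    rw [ellM]; field_simp; ring
  rw [hm]
  generalize ellK (ellM (ρ s)) = K at *
  generalize ellE (ellM (ρ s)) = E at *
  rw [ellM]
  generalize ρ s 0 = a at *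
  generalize ρ s 1 = b at *
  generalize ρ s 2 = c at *
  have n1 : a - b ≠ 0 := by intro; linarith
  have n2 : b - a ≠ 0 := by intro; linarith
  have n3 : b - c ≠ 0 := by intro; linarith
  have n4 : c - b ≠ 0 := by intro; linarith
  have n5 : a - c ≠ 0 := by intro; linarith
  have n6 := hD.ne'
  rw [← neg_sub b a, ← neg_sub c b, ← neg_sub c a]
  field_simp
  ring

theorem partialK_eq {r : Fin 3 → ℝ} (h : Ordered r) (j : Fin 3) :
    partialK j r = waveK r * logDerivK j r := by
  have hu : HasDerivAt (Function.update r j) (Pi.single j (1 : ℝ)) (r j) :=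
    hasDerivAt_update r j (r j)
  have := hasDerivAt_waveK_comp hu (by simpa using h)
  rw [partialK, this.deriv]
  simp [Pi.single_apply]

theorem partialK_div_waveK {r : Fin 3 → ℝ} (h : Ordered r) (j : Fin 3) :
    partialK j r / waveK r = logDerivK j r := by
  rw [partialK_eq h, mul_div_cancel_left₀ _ (waveK_pos h).ne']

/-- The three logarithmic derivatives are multiples of `E - K`, of `E - (1 - m) K` and of `E`,
none of which vanishes. -/
theorem logDerivK_ne_zero {r : Fin 3 → ℝ} (h : Ordered r) (j : Fin 3) : logDerivK j r ≠ 0 := by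
  have hK := ellK_pos h.ellM_lt_one
  have hE := ellE_pos h.ellM_lt_one
  have hEK := ellE_lt_ellK h.ellM_pos h.ellM_lt_one
  have hEK' := one_sub_mul_ellK_lt_ellE h.ellM_pos h.ellM_lt_one
  have hD := h.sub_pos
  have hden := h.sub_ne_zero j
  refine div_ne_zero ?_ (mul_ne_zero (mul_ne_zero four_ne_zero hden.1) hden.2)
  have hm : (1 - ellM r) * (r 2 - r 0) = r 2 - r 1 := by
    rw [ellM]; field_simp; ring
  have e1 : (1 : Fin 3) + 1 = 2 := rfl
  have e2 : (1 : Fin 3) + 2 = 0 := rfl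
  have e3 : (2 : Fin 3) + 1 = 0 := rfl
  have e4 : (2 : Fin 3) + 2 = 1 := rfl
  fin_cases j <;> simp only [Fin.zero_eta, Fin.mk_one, Fin.reduceFinMk, zero_add, e1, e2, e3, e4,
    meanQ0]
  · have : r 1 - (r 2 - r 0) + 2 * (r 2 - r 0) * (ellE (ellM r) / ellK (ellM r))
        + (r 0 - r 1 - r 2) = -(2 * (r 2 - r 0) * (ellK (ellM r) - ellE (ellM r))
          / ellK (ellM r)) := by field_simp; ring
    rw [this, neg_ne_zero]
    have := _root_.sub_pos.2 hEK
    positivity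
  · have : r 1 - (r 2 - r 0) + 2 * (r 2 - r 0) * (ellE (ellM r) / ellK (ellM r))
        + (r 1 - r 2 - r 0) = 2 * (r 2 - r 0) * (ellE (ellM r) - (1 - ellM r) * ellK (ellM r))
          / ellK (ellM r) := by
      field_simp
      linear_combination 2 * ellK (ellM r) * hm
    rw [this]
    have := _root_.sub_pos.2 hEK'
    positivity
  · have : r 1 - (r 2 - r 0) + 2 * (r 2 - r 0) * (ellE (ellM r) / ellK (ellM r))
        + (r 2 - r 0 - r 1) = 2 * (r 2 - r 0) * ellE (ellM r) / ellK (ellM r) := by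
      field_simp; ring
    rw [this]
    positivity

theorem partialK_ne_zero {r : Fin 3 → ℝ} (h : Ordered r) (j : Fin 3) : partialK j r ≠ 0 := by
  rw [partialK_eq h]
  exact mul_ne_zero (waveK_pos h).ne' (logDerivK_ne_zero h j)

/-! ### The mean of the cnoidal wave -/

theorem hasDerivAt_ellF {m : ℝ} (hm : m < 1) (φ : ℝ) :
    HasDerivAt (ellF m) (√(1 - m * Real.sin φ ^ 2))⁻¹ φ :=
  intervalIntegral.integral_hasDerivAt_right
    ((continuous_inv_sqrt_one_sub hm).intervalIntegrable _ _)
    (continuous_inv_sqrt_one_sub hm).stronglyMeasurable.stronglyMeasurableAtFilter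
    (continuous_inv_sqrt_one_sub hm).continuousAt

theorem strictMono_ellF {m : ℝ} (hm : m < 1) : StrictMono (ellF m) :=
  strictMono_of_deriv_pos fun φ => by
    rw [(hasDerivAt_ellF hm φ).deriv]
    exact inv_pos.2 (sqrt_one_sub_pos hm φ)

theorem ellF_neg (m φ : ℝ) : ellF m (-φ) = -ellF m φ := by
  have h := intervalIntegral.integral_comp_neg (a := 0) (b := φ)
    (fun s => (√(1 - m * Real.sin s ^ 2))⁻¹)
  simp only [Real.sin_neg, neg_sq, neg_zero] at h
  rw [ellF, ellF, h, ← intervalIntegral.integral_symm]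

theorem surjective_ellF {m : ℝ} (h0 : 0 ≤ m) (hm : m < 1) : Function.Surjective (ellF m) := by
  -- the integrand is at least `1`
  have hge : ∀ φ, 0 ≤ φ → φ ≤ ellF m φ := fun φ hφ => by
    have h := intervalIntegral.integral_mono_on (μ := volume) (f := fun _ => (1 : ℝ)) hφ
      intervalIntegrable_const ((continuous_inv_sqrt_one_sub hm).intervalIntegrable _ _)
      fun s _ => (one_le_inv₀ (sqrt_one_sub_pos hm s)).2
        (Real.sqrt_le_one.2 (by nlinarith [sq_nonneg (Real.sin s)]))
    simpa [ellF] using h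
  have htop : Tendsto (ellF m) atTop atTop :=
    tendsto_atTop_mono' _ ((eventually_ge_atTop 0).mono hge) tendsto_id
  have hbot : Tendsto (ellF m) atBot atBot := by
    have : ellF m = fun φ => -ellF m (-φ) := by ext φ; rw [ellF_neg, neg_neg]
    rw [this]
    exact tendsto_neg_atTop_atBot.comp (htop.comp tendsto_neg_atBot_atTop)
  exact (continuous_iff_continuousAt.2 fun φ =>
    (hasDerivAt_ellF hm φ).continuousAt).surjective htop hbot

theorem jacobiAm_ellF {m : ℝ} (hm : m < 1) (φ : ℝ) : jacobiAm m (ellF m φ) = φ :=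
  Function.leftInverse_invFun (strictMono_ellF hm).injective φ

theorem ellF_jacobiAm {m : ℝ} (h0 : 0 ≤ m) (hm : m < 1) (z : ℝ) : ellF m (jacobiAm m z) = z :=
  Function.rightInverse_invFun (surjective_ellF h0 hm) z

theorem jacobiAm_neg {m : ℝ} (h0 : 0 ≤ m) (hm : m < 1) (z : ℝ) :
    jacobiAm m (-z) = -jacobiAm m z :=
  (strictMono_ellF hm).injective (by rw [ellF_neg, ellF_jacobiAm h0 hm, ellF_jacobiAm h0 hm])

theorem continuous_jacobiAm {m : ℝ} (h0 : 0 ≤ m) (hm : m < 1) : Continuous (jacobiAm m) := by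
  have hmono : Monotone (jacobiAm m) := fun a b hab =>
    (strictMono_ellF hm).le_iff_le.1 (by rwa [ellF_jacobiAm h0 hm, ellF_jacobiAm h0 hm])
  exact hmono.continuous_of_surjective fun φ => ⟨ellF m φ, jacobiAm_ellF hm φ⟩

theorem continuous_jacobiCn {m : ℝ} (h0 : 0 ≤ m) (hm : m < 1) : Continuous (jacobiCn m) :=
  Real.continuous_cos.comp (continuous_jacobiAm h0 hm)

theorem cnoidal_neg {r : Fin 3 → ℝ} (h : Ordered r) (θ : ℝ) :
    cnoidal r (-θ) = cnoidal r θ := by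
  simp only [cnoidal, jacobiCn, mul_neg, jacobiAm_neg h.ellM_pos.le h.ellM_lt_one, Real.cos_neg]

theorem integral_jacobiCn_sq {m : ℝ} (h0 : 0 < m) (hm : m < 1) :
    ∫ z in (0 : ℝ)..ellK m, jacobiCn m z ^ 2 = (ellE m - (1 - m) * ellK m) / m := by
  have h := intervalIntegral.integral_comp_mul_deriv (a := 0) (b := Real.pi / 2)
    (g := fun z => jacobiCn m z ^ 2)
    (fun φ _ => hasDerivAt_ellF hm φ) (continuous_inv_sqrt_one_sub hm).continuousOn
    ((continuous_jacobiCn h0.le hm).pow 2)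
  have hz : ellF m 0 = 0 := by simp [ellF]
  rw [hz] at h
  rw [ellK, ← h, ← ellK, ← integral_cos_sq_div_sqrt h0.ne' hm]
  simp only [Function.comp, jacobiCn, jacobiAm_ellF hm]

/-- The mean of the cnoidal wave is `Q₀`; the amplitude function turns the integral of `cn²` over a
period into a complete elliptic integral. -/
theorem avg_cnoidal {r : Fin 3 → ℝ} (h : Ordered r) : avg (cnoidal r) = meanQ0 r := by
  have h0 := h.ellM_pos
  have h1 := h.ellM_lt_one
  have hD := h.sub_pos
  have hK := ellK_pos h1
  have hcont : Continuous fun z => jacobiCn (ellM r) z ^ 2 :=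
    (continuous_jacobiCn h0.le h1).pow 2
  have heven : ∀ z, jacobiCn (ellM r) (-z) ^ 2 = jacobiCn (ellM r) z ^ 2 := fun z => by
    simp only [jacobiCn, jacobiAm_neg h0.le h1, Real.cos_neg]
  have hsym : ∫ z in -ellK (ellM r)..ellK (ellM r), jacobiCn (ellM r) z ^ 2
      = 2 * ((ellE (ellM r) - (1 - ellM r) * ellK (ellM r)) / ellM r) := by
    have hneg := intervalIntegral.integral_comp_neg (a := 0) (b := ellK (ellM r))
      (fun z => jacobiCn (ellM r) z ^ 2)
    simp only [heven, neg_zero] at hneg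
    rw [← intervalIntegral.integral_add_adjacent_intervals (hcont.intervalIntegrable _ 0)
      (hcont.intervalIntegrable 0 _), ← hneg, integral_jacobiCn_sq h0 h1]
    ring
  have hsub := intervalIntegral.integral_comp_mul_left (a := -1 / 2) (b := 1 / 2)
    (fun z => jacobiCn (ellM r) z ^ 2) (c := 2 * ellK (ellM r)) (by positivity)
  rw [show 2 * ellK (ellM r) * (-1 / 2) = -ellK (ellM r) by ring,
    show 2 * ellK (ellM r) * (1 / 2) = ellK (ellM r) by ring, hsym] at hsub
  have hi : IntervalIntegrable (fun θ => ((-r 0 + r 1 + r 2) - (r 0 - r 1 + r 2)) *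
      jacobiCn (ellM r) (2 * ellK (ellM r) * θ) ^ 2) volume (-1 / 2) (1 / 2) :=
    (continuous_const.mul (hcont.comp (continuous_const.mul continuous_id))).intervalIntegrable _ _
  simp only [avg, cnoidal]
  rw [intervalIntegral.integral_add intervalIntegrable_const hi,
    intervalIntegral.integral_const_mul, hsub, meanQ0, intervalIntegral.integral_const]
  have hm : ellM r * (r 2 - r 0) = r 1 - r 0 := by
    rw [ellM]; field_simp
  generalize ellK (ellM r) = K at *
  generalize ellE (ellM r) = E at *
  generalize ellM r = m at *
  simp only [smul_eq_mul]
  have hr1 : r 1 = r 0 + m * (r 2 - r 0) := by rw [hm]; ring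
  rw [hr1]
  field_simp
  ring

/-! ### The Riemann form of the Whitham equations -/

theorem hasDerivAt_slice_fst {E : Type} [NormedAddCommGroup E] [NormedSpace ℝ E]
    {f : ℝ → ℝ → E} {x t : ℝ}
    (h : DifferentiableAt ℝ (fun p : ℝ × ℝ => f p.1 p.2) (x, t)) :
    HasDerivAt (fun y => f y t) (deriv (fun y => f y t) x) x :=
  (h.comp (f := fun y : ℝ => (y, t)) x (by fun_prop)).hasDerivAt

theorem hasDerivAt_slice_snd {E : Type} [NormedAddCommGroup E] [NormedSpace ℝ E]
    {f : ℝ → ℝ → E} {x t : ℝ}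
    (h : DifferentiableAt ℝ (fun p : ℝ × ℝ => f p.1 p.2) (x, t)) :
    HasDerivAt (fun s => f x s) (deriv (fun s => f x s) t) t :=
  (h.comp (f := fun s : ℝ => (x, s)) t (by fun_prop)).hasDerivAt

theorem hasDerivAt_dx {f : ℝ → ℝ → ℝ} {x t : ℝ}
    (h : DifferentiableAt ℝ (fun p : ℝ × ℝ => f p.1 p.2) (x, t)) :
    HasDerivAt (fun y => f y t) (dx f x t) x := hasDerivAt_slice_fst h

theorem hasDerivAt_dt {f : ℝ → ℝ → ℝ} {x t : ℝ}
    (h : DifferentiableAt ℝ (fun p : ℝ × ℝ => f p.1 p.2) (x, t)) :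
    HasDerivAt (fun s => f x s) (dt f x t) t := hasDerivAt_slice_snd h

/-- The coefficient `P₀ - (3/2) ∂_j C₂` with which the `j`-th Riemann equation enters the third
Whitham equation. -/
noncomputable def momentumWeight (j : Fin 3) (r : Fin 3 → ℝ) : ℝ :=
  velV r * meanQ0 r + constC1 r
    - 3 * (-3 * r j ^ 2 + 2 * r j * (r (j + 1) + r (j + 2)) + (r (j + 1) - r (j + 2)) ^ 2)

theorem hasDerivAt_velV_comp {ρ : ℝ → Fin 3 → ℝ} {ρ' : Fin 3 → ℝ} {s : ℝ}
    (hρ : HasDerivAt ρ ρ' s) :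
    HasDerivAt (fun s => velV (ρ s)) (2 * ∑ j, ρ' j) s := by
  have hc := hasDerivAt_pi.1 hρ
  refine ((((hc 0).add (hc 1)).add (hc 2)).const_mul 2).congr_deriv ?_
  rw [Fin.sum_univ_three]

theorem hasDerivAt_constC1_comp {ρ : ℝ → Fin 3 → ℝ} {ρ' : Fin 3 → ℝ} {s : ℝ}
    (hρ : HasDerivAt ρ ρ' s) :
    HasDerivAt (fun s => constC1 (ρ s))
      (2 * ∑ j, (ρ s j - ρ s (j + 1) - ρ s (j + 2)) * ρ' j) s := by
  have hc := hasDerivAt_pi.1 hρ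
  have h0 := hc 0
  have h1 := hc 1
  have h2 := hc 2
  refine ((((h0.pow 2).add (h1.pow 2)).add (h2.pow 2)).sub
    ((((h0.mul h1).add (h1.mul h2)).add (h2.mul h0)).const_mul 2)).congr_deriv ?_
  rw [Fin.sum_univ_three, show (1 : Fin 3) + 1 = 2 from rfl, show (1 : Fin 3) + 2 = 0 from rfl,
    show (2 : Fin 3) + 1 = 0 from rfl, show (2 : Fin 3) + 2 = 1 from rfl]
  simp only [zero_add]
  push_cast
  ring

theorem hasDerivAt_constC2_comp {ρ : ℝ → Fin 3 → ℝ} {ρ' : Fin 3 → ℝ} {s : ℝ}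
    (hρ : HasDerivAt ρ ρ' s) :
    HasDerivAt (fun s => constC2 (ρ s))
      (2 * ∑ j, (-3 * ρ s j ^ 2 + 2 * ρ s j * (ρ s (j + 1) + ρ s (j + 2))
        + (ρ s (j + 1) - ρ s (j + 2)) ^ 2) * ρ' j) s := by
  have hc := hasDerivAt_pi.1 hρ
  have h0 := hc 0
  have h1 := hc 1
  have h2 := hc 2
  refine (((((((h0.pow 3).neg.sub (h1.pow 3)).sub (h2.pow 3)).add
    ((h0.pow 2).mul (h1.add h2))).add ((h1.pow 2).mul (h2.add h0))).add
    ((h2.pow 2).mul (h0.add h1))).sub (((h0.const_mul 2).mul h1).mul h2)).const_mul 2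
    |>.congr_deriv ?_
  rw [Fin.sum_univ_three, show (1 : Fin 3) + 1 = 2 from rfl, show (1 : Fin 3) + 2 = 0 from rfl,
    show (2 : Fin 3) + 1 = 0 from rfl, show (2 : Fin 3) + 2 = 1 from rfl]
  simp only [zero_add, Pi.pow_apply, Pi.mul_apply, Pi.add_apply]
  push_cast
  ring

section Point

variable {r : ℝ → ℝ → Fin 3 → ℝ} {x t : ℝ}

theorem hasDerivAt_riemann_dx
    (hr : DifferentiableAt ℝ (fun p : ℝ × ℝ => r p.1 p.2) (x, t)) :
    HasDerivAt (fun y => r y t) (fun j => dx (fun x t => r x t j) x t) x :=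
  hasDerivAt_pi.2 fun j => hasDerivAt_dx (f := fun x t => r x t j) (differentiableAt_pi.1 hr j)

theorem hasDerivAt_riemann_dt
    (hr : DifferentiableAt ℝ (fun p : ℝ × ℝ => r p.1 p.2) (x, t)) :
    HasDerivAt (fun s => r x s) (fun j => dt (fun x t => r x t j) x t) t :=
  hasDerivAt_pi.2 fun j => hasDerivAt_dt (f := fun x t => r x t j) (differentiableAt_pi.1 hr j)

theorem logDerivK_mul_riemannLead (ho : Ordered (r x t)) (j : Fin 3) :
    logDerivK j (r x t) * riemannLead r j x t
      = logDerivK j (r x t) * dt (fun x t => r x t j) x t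
        + (logDerivK j (r x t) * velV (r x t) + 2) * dx (fun x t => r x t j) x t := by
  have h1 := logDerivK_ne_zero ho j
  have h2 := (waveK_pos ho).ne'
  rw [riemannLead, charVel, partialK_eq ho]
  field_simp

/-- Conservation of waves in terms of the Riemann equations. -/
theorem waveConservation_eq (ho : Ordered (r x t))
    (hr : DifferentiableAt ℝ (fun p : ℝ × ℝ => r p.1 p.2) (x, t)) :
    dt (fun x t => waveK (r x t)) x t + dx (fun x t => waveK (r x t) * velV (r x t)) x t
      = waveK (r x t) * ∑ j, logDerivK j (r x t) * riemannLead r j x t := by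
  have hx := hasDerivAt_riemann_dx hr
  have ht := hasDerivAt_riemann_dt hr
  rw [dt, dx, (hasDerivAt_waveK_comp ht ho).deriv,
    ((hasDerivAt_waveK_comp hx ho).fun_mul (hasDerivAt_velV_comp hx)).deriv]
  simp only [logDerivK_mul_riemannLead ho, Fin.sum_univ_three]
  ring

/-- The averaged KdV equation in terms of the Riemann equations: `∂_j P₀ = v_j ∂_j Q₀`. -/
theorem massConservation_eq (ho : Ordered (r x t))
    (hr : DifferentiableAt ℝ (fun p : ℝ × ℝ => r p.1 p.2) (x, t)) :
    dt (fun x t => meanQ0 (r x t)) x t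
      + dx (fun x t => velV (r x t) * meanQ0 (r x t) + constC1 (r x t)) x t
      = ∑ j, (meanQ0 (r x t) + (r x t j - r x t (j + 1) - r x t (j + 2)))
        * (logDerivK j (r x t) * riemannLead r j x t) := by
  have hx := hasDerivAt_riemann_dx hr
  have ht := hasDerivAt_riemann_dt hr
  rw [dt, dx, (hasDerivAt_meanQ0_comp ht ho).deriv,
    (((hasDerivAt_velV_comp hx).fun_mul (hasDerivAt_meanQ0_comp hx ho)).fun_add
      (hasDerivAt_constC1_comp hx)).deriv]
  simp only [logDerivK_mul_riemannLead ho, Fin.sum_univ_three]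
  ring

theorem logDerivK_mul {ρ : Fin 3 → ℝ} (h : Ordered ρ) (j : Fin 3) :
    logDerivK j ρ * (4 * (ρ j - ρ (j + 1)) * (ρ j - ρ (j + 2)))
      = meanQ0 ρ + (ρ j - ρ (j + 1) - ρ (j + 2)) := by
  have := h.sub_ne_zero j
  exact div_mul_cancel₀ _ (mul_ne_zero (mul_ne_zero four_ne_zero this.1) this.2)

/-- The averaged momentum equation in terms of the Riemann equations. Here the relation
`4 (r_j - r_l) (r_j - r_m) ∂_j k / k = Q₀ + r_j - r_l - r_m` enters. -/
theorem momentumConservation_eq (ho : Ordered (r x t))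
    (hr : DifferentiableAt ℝ (fun p : ℝ × ℝ => r p.1 p.2) (x, t)) :
    dt (fun x t => velV (r x t) * meanQ0 (r x t) + constC1 (r x t)) x t
      + dx (fun x t => velV (r x t) * (velV (r x t) * meanQ0 (r x t) + constC1 (r x t))
        - 3 * constC2 (r x t)) x t
      = ∑ j, momentumWeight j (r x t) * (logDerivK j (r x t) * riemannLead r j x t) := by
  have hx := hasDerivAt_riemann_dx hr
  have ht := hasDerivAt_riemann_dt hr
  have hP : ∀ {ρ : ℝ → Fin 3 → ℝ} {ρ' : Fin 3 → ℝ} {s : ℝ}, HasDerivAt ρ ρ' s →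
      Ordered (ρ s) → HasDerivAt (fun s => velV (ρ s) * meanQ0 (ρ s) + constC1 (ρ s)) _ s :=
    fun hρ ho => ((hasDerivAt_velV_comp hρ).fun_mul (hasDerivAt_meanQ0_comp hρ ho)).fun_add
      (hasDerivAt_constC1_comp hρ)
  rw [dt, dx, (hP ht ho).deriv, (((hasDerivAt_velV_comp hx).fun_mul (hP hx ho)).fun_sub
    ((hasDerivAt_constC2_comp hx).const_mul 3)).deriv]
  simp only [logDerivK_mul_riemannLead ho, Fin.sum_univ_three, momentumWeight]
  have h0 := logDerivK_mul ho 0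
  have h1 := logDerivK_mul ho 1
  have h2 := logDerivK_mul ho 2
  rw [show (1 : Fin 3) + 1 = 2 from rfl, show (1 : Fin 3) + 2 = 0 from rfl] at *
  rw [show (2 : Fin 3) + 1 = 0 from rfl, show (2 : Fin 3) + 2 = 1 from rfl] at *
  simp only [zero_add, velV, constC1] at *
  generalize meanQ0 (r x t) = Q at *
  generalize logDerivK 0 (r x t) = κ₀ at *
  generalize logDerivK 1 (r x t) = κ₁ at *
  generalize logDerivK 2 (r x t) = κ₂ at *
  generalize dt (fun x t => r x t 0) x t = a₀
  generalize dt (fun x t => r x t 1) x t = a₁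
  generalize dt (fun x t => r x t 2) x t = a₂
  generalize dx (fun x t => r x t 0) x t = b₀
  generalize dx (fun x t => r x t 1) x t = b₁
  generalize dx (fun x t => r x t 2) x t = b₂
  generalize r x t 0 = r₀ at *
  generalize r x t 1 = r₁ at *
  generalize r x t 2 = r₂ at *
  linear_combination (-2 * a₀ - 4 * (r₀ + r₁ + r₂) * b₀) * h0
    + (-2 * a₁ - 4 * (r₀ + r₁ + r₂) * b₁) * h1 + (-2 * a₂ - 4 * (r₀ + r₁ + r₂) * b₂) * h2

end Point

/-- Inversion of the `3 × 3` system: its matrix is of Vandermonde type in `r₁, r₂, r₃`, so that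
Lagrange interpolation gives the solution. -/
theorem riemann_system_iff {ρ : Fin 3 → ℝ} (h : Ordered ρ) (R : Fin 3 → ℝ) (Y₁ Y₂ : ℝ) :
    (waveK ρ * ∑ j, logDerivK j ρ * R j = 0 ∧
      (∑ j, (meanQ0 ρ + (ρ j - ρ (j + 1) - ρ (j + 2))) * (logDerivK j ρ * R j)) + Y₁ = 0 ∧
      (∑ j, momentumWeight j ρ * (logDerivK j ρ * R j)) + Y₂ = 0) ↔
    ∀ j, R j + riemannCorr ρ Y₁ Y₂ j = 0 := by
  have hk := (waveK_pos h).ne'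
  have key : ∀ j, R j + riemannCorr ρ Y₁ Y₂ j = 0 ↔
      24 * (ρ j - ρ (j + 1)) * (ρ j - ρ (j + 2)) * (logDerivK j ρ * R j)
        + (Y₂ + 6 * (ρ j - ρ (j + 1) - ρ (j + 2)) * Y₁) = 0 := fun j => by
    have hs := h.sub_ne_zero j
    have hκ := logDerivK_ne_zero h j
    have h1 := hs.1
    have h2 := hs.2
    rw [riemannCorr, partialK_div_waveK h, add_div' _ _ _ (by simp [h1, h2, hκ]),
      div_eq_zero_iff, or_iff_left (by simp [h1, h2, hκ])]
    ring_nf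
  simp only [key, mul_eq_zero, hk, false_or, Fin.forall_fin_succ, Fin.sum_univ_three,
    momentumWeight]
  have n0 := h.sub_ne_zero 0
  have n1 := h.sub_ne_zero 1
  generalize hS : (fun j => logDerivK j ρ * R j) = S
  have hS' : ∀ j, logDerivK j ρ * R j = S j := fun j => congrFun hS j
  simp only [hS', Fin.succ_zero_eq_one, Fin.succ_one_eq_two, IsEmpty.forall_iff, and_true,
    show (1 : Fin 3) + 1 = 2 from rfl, show (1 : Fin 3) + 2 = 0 from rfl,
    show (2 : Fin 3) + 1 = 0 from rfl, show (2 : Fin 3) + 2 = 1 from rfl, zero_add] at n0 n1 ⊢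
  generalize velV ρ * meanQ0 ρ + constC1 ρ = P
  generalize meanQ0 ρ = Q
  generalize S 0 = S₀
  generalize S 1 = S₁
  generalize S 2 = S₂
  generalize ρ 0 = a at *
  generalize ρ 1 = b at *
  generalize ρ 2 = c at *
  obtain ⟨n01, n02⟩ := n0
  obtain ⟨n12, n10⟩ := n1
  constructor
  · rintro ⟨e1, e2, e3⟩
    -- each combination has the weights `24 (r_i - r_l) (r_i - r_m)`, which vanish for `i ≠ j`
    refine ⟨?_, ?_, ?_⟩
    · linear_combination e3 + 6 * (a - b - c) * (e2 - Q * e1) - (P - 3 * (-3 * b ^ 2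
        + 2 * b * (c + a) + (c - a) ^ 2) + 6 * (a - b - c) * (b - c - a)) * e1
    · linear_combination e3 + 6 * (b - c - a) * (e2 - Q * e1) - (P - 3 * (-3 * c ^ 2
        + 2 * c * (a + b) + (a - b) ^ 2) + 6 * (b - c - a) * (c - a - b)) * e1
    · linear_combination e3 + 6 * (c - a - b) * (e2 - Q * e1) - (P - 3 * (-3 * a ^ 2
        + 2 * a * (b + c) + (b - c) ^ 2) + 6 * (c - a - b) * (a - b - c)) * e1
  · rintro ⟨e1, e2, e3⟩
    have n20 : c - a ≠ 0 := by rw [← neg_sub]; exact neg_ne_zero.2 n02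
    have n21 : c - b ≠ 0 := by rw [← neg_sub]; exact neg_ne_zero.2 n12
    have s0 : S₀ = -(Y₂ + 6 * (a - b - c) * Y₁) / (24 * (a - b) * (a - c)) := by
      rw [eq_div_iff (by simp [n01, n02])]; linear_combination e1
    have s1 : S₁ = (Y₂ + 6 * (b - c - a) * Y₁) / (24 * (b - c) * (a - b)) := by
      rw [eq_div_iff (by simp [n01, n12])]; linear_combination -e2
    have s2 : S₂ = -(Y₂ + 6 * (c - a - b) * Y₁) / (24 * (a - c) * (b - c)) := by
      rw [eq_div_iff (by simp [n02, n12])]; linear_combination e3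
    rw [s0, s1, s2]
    refine ⟨?_, ?_, ?_⟩ <;> field_simp <;> ring

theorem riemannCorr_smul (ρ : Fin 3 → ℝ) (c a b : ℝ) (j : Fin 3) :
    riemannCorr ρ (c * a) (c * b) j = c * riemannCorr ρ a b j := by
  rw [riemannCorr, riemannCorr]
  ring

section Point

variable {r : ℝ → ℝ → Fin 3 → ℝ} {x t : ℝ}

theorem differentiableAt_comp_riemann {f : (Fin 3 → ℝ) → ℝ}
    (hf : ContDiffOn ℝ ∞ f {r | Ordered r}) (ho : Ordered (r x t))
    (hr : DifferentiableAt ℝ (fun p : ℝ × ℝ => r p.1 p.2) (x, t)) :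
    DifferentiableAt ℝ (fun p : ℝ × ℝ => f (r p.1 p.2)) (x, t) :=
  ((hf.contDiffAt (isOpen_ordered.mem_nhds ho)).differentiableAt (by simp)).comp
    (g := f) (x, t) hr

theorem contDiff_velV : ContDiff ℝ ∞ velV := by unfold velV; fun_prop

theorem contDiff_constC1 : ContDiff ℝ ∞ constC1 := by unfold constC1; fun_prop

theorem contDiff_constC2 : ContDiff ℝ ∞ constC2 := by unfold constC2; fun_prop

theorem classicalWhitham_iff (ho : Ordered (r x t))
    (hr : DifferentiableAt ℝ (fun p : ℝ × ℝ => r p.1 p.2) (x, t)) :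
    ClassicalWhitham r x t ↔ ∀ j, riemannLead r j x t = 0 := by
  have h := riemann_system_iff ho (fun j => riemannLead r j x t) 0 0
  simp only [add_zero, riemannCorr, mul_zero, zero_div] at h
  rw [← h, ← waveConservation_eq ho hr, ← massConservation_eq ho hr,
    ← momentumConservation_eq ho hr]
  rfl

/-- The all-orders system is the classical one with right-hand sides `-ε² X₁` and `-ε² X₂` in the
last two equations. -/
theorem allOrdersWhitham_iff {ε : ℝ} (hε : ε ≠ 0) {Q : ℝ → ℝ → ℝ} (ho : Ordered (r x t))
    (hr : DifferentiableAt ℝ (fun p : ℝ × ℝ => r p.1 p.2) (x, t))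
    (hQ : DifferentiableAt ℝ (fun p : ℝ × ℝ => Q p.1 p.2) (x, t)) :
    AllOrdersWhitham ε r Q x t ↔ ∀ j, riemannLead r j x t + ε ^ 2 *
      riemannCorrField ε r (fun x t => (Q x t - meanQ0 (r x t)) / ε ^ 2) Q j x t = 0 := by
  have hQ0 := differentiableAt_comp_riemann contDiffOn_meanQ0 ho hr
  have hV := differentiableAt_comp_riemann contDiff_velV.contDiffOn ho hr
  have hC1 := differentiableAt_comp_riemann contDiff_constC1.contDiffOn ho hr
  have hC2 := differentiableAt_comp_riemann contDiff_constC2.contDiffOn ho hr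
  simp only [riemannCorrField, ← riemannCorr_smul]
  rw [← riemann_system_iff ho, ← waveConservation_eq ho hr, ← massConservation_eq ho hr,
    ← momentumConservation_eq ho hr]
  have Qx := hasDerivAt_dx hQ
  have Qt := hasDerivAt_dt hQ
  have Q0x := hasDerivAt_dx (f := fun x t => meanQ0 (r x t)) hQ0
  have Q0t := hasDerivAt_dt (f := fun x t => meanQ0 (r x t)) hQ0
  have Vx := hasDerivAt_dx (f := fun x t => velV (r x t)) hV
  have Vt := hasDerivAt_dt (f := fun x t => velV (r x t)) hV
  have C1x := hasDerivAt_dx (f := fun x t => constC1 (r x t)) hC1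
  have C1t := hasDerivAt_dt (f := fun x t => constC1 (r x t)) hC1
  have C2x := hasDerivAt_dx (f := fun x t => constC2 (r x t)) hC2
  unfold AllOrdersWhitham X1 X2
  refine and_congr Iff.rfl (and_congr ?_ ?_)
  · generalize Phi1 _ _ _ _ = Φ
    simp only [dx, dt] at *
    rw [Qt.deriv, Q0t.deriv, ((Vx.fun_mul Qx).fun_add C1x).deriv,
      ((Vx.fun_mul Q0x).fun_add C1x).deriv, ((Qt.fun_sub Q0t).div_const (ε ^ 2)).deriv,
      (Vx.fun_mul ((Qx.fun_sub Q0x).div_const (ε ^ 2))).deriv]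
    refine Eq.congr_left ?_
    field_simp
    ring
  · generalize Phi2 _ _ _ _ _ _ _ = Φ
    simp only [dx, dt] at *
    rw [((Vt.fun_mul Qt).fun_add C1t).deriv, ((Vt.fun_mul Q0t).fun_add C1t).deriv,
      ((Vx.fun_mul ((Vx.fun_mul Qx).fun_add C1x)).fun_sub (C2x.const_mul 3)).deriv,
      ((Vx.fun_mul ((Vx.fun_mul Q0x).fun_add C1x)).fun_sub (C2x.const_mul 3)).deriv,
      (Vt.fun_mul ((Qt.fun_sub Q0t).div_const (ε ^ 2))).deriv,
      ((Vx.fun_pow 2).fun_mul ((Qx.fun_sub Q0x).div_const (ε ^ 2))).deriv]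
    refine Eq.congr_left ?_
    field_simp
    push_cast
    ring

end Point

/-! ### Parity of the corrections -/

theorem avg_eq_zero_of_odd {f : ℝ → ℝ} (hf : ∀ θ, f (-θ) = -f θ) : avg f = 0 := by
  have h := intervalIntegral.integral_comp_neg (a := -1 / 2) (b := 1 / 2) f
  simp only [hf, intervalIntegral.integral_neg] at h
  rw [show -(1 / 2 : ℝ) = -1 / 2 by ring, show -(-1 / 2 : ℝ) = 1 / 2 by ring] at h
  rw [avg]
  linarith

/-- The zero-average antiderivative reverses parity. -/
theorem hatInt_neg {f : ℝ → ℝ} {σ : ℝ} (hσ : σ = 1 ∨ σ = -1) (hf : ∀ θ, f (-θ) = σ * f θ)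
    (θ : ℝ) : hatInt f (-θ) = -σ * hatInt f θ := by
  have hg : ∀ z, f (-z) - avg f = σ * (f z - avg f) := fun z => by
    rcases hσ with rfl | rfl
    · rw [hf]; ring
    · rw [avg_eq_zero_of_odd (by simpa using hf), hf]; ring
  have hI : ∀ φ, ∫ z in (0 : ℝ)..(-φ), (f z - avg f)
      = -σ * ∫ z in (0 : ℝ)..φ, (f z - avg f) := fun φ => by
    have h := intervalIntegral.integral_comp_neg (a := 0) (b := φ) (fun z => f z - avg f)
    simp only [hg, intervalIntegral.integral_const_mul, neg_zero] at h
    rw [intervalIntegral.integral_symm, ← h]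
    ring
  rw [hatInt, hatInt, hI]
  rcases hσ with rfl | rfl
  · rw [avg_eq_zero_of_odd (f := fun φ => ∫ z in (0 : ℝ)..φ, (f z - avg f))
      (fun φ => by rw [hI]; ring)]
    ring
  · ring

theorem deriv_neg_of_parity {f : ℝ → ℝ} {σ : ℝ} (hf : ∀ θ, f (-θ) = σ * f θ) (θ : ℝ) :
    deriv f (-θ) = -σ * deriv f θ := by
  have h := deriv_comp_neg f θ
  simp only [hf] at h
  rw [deriv_const_mul_field] at h
  linarith

theorem dx_eq_mul {Ω : Set (ℝ × ℝ)} (hΩ : IsOpen Ω) {f g : ℝ → ℝ → ℝ} {σ : ℝ}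
    (h : ∀ x t, (x, t) ∈ Ω → f x t = σ * g x t) {x t : ℝ} (hx : (x, t) ∈ Ω) :
    dx f x t = σ * dx g x t := by
  have hev : (fun y => f y t) =ᶠ[𝓝 x] fun y => σ * g y t := by
    have hc : ContinuousAt (fun y : ℝ => (y, t)) x := by fun_prop
    filter_upwards [hc.preimage_mem_nhds (hΩ.mem_nhds hx)] with y hy using h y t hy
  rw [dx, hev.deriv_eq, deriv_const_mul_field, dx]

theorem dt_eq_mul {Ω : Set (ℝ × ℝ)} (hΩ : IsOpen Ω) {f g : ℝ → ℝ → ℝ} {σ : ℝ}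
    (h : ∀ x t, (x, t) ∈ Ω → f x t = σ * g x t) {x t : ℝ} (hx : (x, t) ∈ Ω) :
    dt f x t = σ * dt g x t := by
  have hev : (fun s => f x s) =ᶠ[𝓝 t] fun s => σ * g x s := by
    have hc : ContinuousAt (fun s : ℝ => (x, s)) t := by fun_prop
    filter_upwards [hc.preimage_mem_nhds (hΩ.mem_nhds hx)] with s hs using h x s hs
  rw [dt, hev.deriv_eq, deriv_const_mul_field, dt]

/-- If `u_i` has the parity of `i` for `i ≤ n`, then the forcing `F_{n+1}` has that of `n + 1`. -/
theorem forcing_neg {Ω : Set (ℝ × ℝ)} (hΩ : IsOpen Ω) (k : ℝ → ℝ → ℝ)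
    {u : ℕ → ℝ → ℝ → ℝ → ℝ} {n : ℕ}
    (hu : ∀ i ≤ n, ∀ x t, (x, t) ∈ Ω → ∀ θ, u i (-θ) x t = (-1) ^ i * u i θ x t)
    {x t : ℝ} (hx : (x, t) ∈ Ω) (θ : ℝ) :
    forcing k u n (-θ) x t = (-1) ^ (n + 1) * forcing k u n θ x t := by
  have hσ : ∀ i : ℕ, (-1 : ℝ) ^ i = 1 ∨ (-1 : ℝ) ^ i = -1 := neg_one_pow_eq_or ℝ
  have hneg : -(-1 : ℝ) ^ n = (-1) ^ (n + 1) := by rw [pow_succ]; ring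
  have h1 : ∑ i ∈ Finset.Ico 1 (n + 1), u i (-θ) x t * u (n + 1 - i) (-θ) x t
      = (-1) ^ (n + 1) * ∑ i ∈ Finset.Ico 1 (n + 1), u i θ x t * u (n + 1 - i) θ x t := by
    rw [Finset.mul_sum]
    refine Finset.sum_congr rfl fun i hi => ?_
    rw [Finset.mem_Ico] at hi
    rw [hu i (by omega) x t hx, hu (n + 1 - i) (by omega) x t hx,
      show (-1 : ℝ) ^ (n + 1) = (-1) ^ i * (-1) ^ (n + 1 - i) by
        rw [← pow_add]; congr 1; omega]
    ring
  have h2 : dt (fun x t => hatInt (fun z => u n z x t) (-θ)) x t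
      = (-1) ^ (n + 1) * dt (fun x t => hatInt (fun z => u n z x t) θ) x t :=
    dt_eq_mul hΩ (fun x t hx => by
      rw [hatInt_neg (hσ n) (hu n le_rfl x t hx), hneg]) hx
  have h3 : dx (fun x t => hatInt (fun z => ∑ i ∈ Finset.range (n + 1),
        u i z x t * u (n - i) z x t) (-θ)) x t
      = (-1) ^ (n + 1) * dx (fun x t => hatInt (fun z => ∑ i ∈ Finset.range (n + 1),
        u i z x t * u (n - i) z x t) θ) x t :=
    dx_eq_mul hΩ (fun x t hx => by
      rw [hatInt_neg (hσ n) (f := fun z => ∑ i ∈ Finset.range (n + 1),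
        u i z x t * u (n - i) z x t) ?_, hneg]
      intro z
      rw [Finset.mul_sum]
      refine Finset.sum_congr rfl fun i hi => ?_
      rw [Finset.mem_range] at hi
      rw [hu i (by omega) x t hx, hu (n - i) (by omega) x t hx,
        show (-1 : ℝ) ^ n = (-1) ^ i * (-1) ^ (n - i) by rw [← pow_add]; congr 1; omega]
      ring) hx
  have h4 : dx (fun x t => k x t * deriv (fun z => u n z x t) (-θ)) x t
      = (-1) ^ (n + 1) * dx (fun x t => k x t * deriv (fun z => u n z x t) θ) x t :=
    dx_eq_mul hΩ (fun x t hx => by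
      rw [deriv_neg_of_parity (hu n le_rfl x t hx), hneg]; ring) hx
  have h5 : ∀ x t, (x, t) ∈ Ω →
      lag u 1 n (-θ) x t = (-1) ^ (n + 1) * lag u 1 n θ x t := fun x t hx => by
    unfold lag
    split_ifs with h
    · rw [hu (n - 1) (by omega) x t hx, show n + 1 = n - 1 + 2 by omega, pow_add]
      norm_num
    · simp
  have h6 : ∀ x t, (x, t) ∈ Ω → hatInt (fun z => lag u 2 n z x t) (-θ)
      = (-1) ^ (n + 1) * hatInt (fun z => lag u 2 n z x t) θ := fun x t hx => by
    rw [hatInt_neg (hσ n), hneg]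
    intro z
    unfold lag
    split_ifs with h
    · rw [hu (n - 2) (by omega) x t hx, show (-1 : ℝ) ^ n = (-1) ^ (n - 2 + 2) by
        congr 1; omega, pow_add]
      norm_num
    · simp
  have h7 := fun x t hx => dx_eq_mul (x := x) (t := t) hΩ h5 hx
  have h8 := fun x t hx => dx_eq_mul (x := x) (t := t) hΩ h6 hx
  have h9 := fun x t hx => dx_eq_mul (x := x) (t := t) hΩ h8 hx
  rw [forcing, forcing, h1, h2, h3, h4, h5 x t hx, h7 x t hx, dx_eq_mul hΩ h7 hx,
    dx_eq_mul hΩ h9 hx]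
  ring

/-- Uniqueness for the linear equation `y'' = a y` with vanishing data at `0`. -/
theorem eq_zero_of_deriv_deriv_eq_mul {a y y' : ℝ → ℝ} (ha : Continuous a)
    (hy : ∀ θ, HasDerivAt y (y' θ) θ) (hy' : ∀ θ, HasDerivAt y' (a θ * y θ) θ)
    (h0 : y 0 = 0) (h0' : y' 0 = 0) (θ : ℝ) : y θ = 0 := by
  -- as a first-order system for `(y, y')`, Lipschitz on the compact segment `[-T, T]`
  set T := |θ| + 1
  have hθ := abs_le.1 (le_refl |θ|)
  obtain ⟨M, hM⟩ := (isCompact_Icc (a := -T) (b := T)).exists_bound_of_continuousOn ha.continuousOn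
  have hT : 0 < T := by positivity
  have hM0 : 0 ≤ M := (norm_nonneg _).trans (hM 0 ⟨by linarith, hT.le⟩)
  have hf : ∀ s, HasDerivAt (fun s => (y s, y' s)) (y' s, a s * y s) s :=
    fun s => (hy s).prodMk (hy' s)
  have huniq := ODE_solution_unique_of_mem_Icc (v := fun s (p : ℝ × ℝ) => (p.2, a s * p.1))
    (s := fun _ => univ) (K := Real.toNNReal (1 + M)) (f := fun s => (y s, y' s))
    (g := fun _ => 0) (a := -T) (b := T) (t₀ := 0)
    (fun s hs => (LipschitzWith.of_dist_le_mul fun p q => by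
      have hb := hM s ⟨hs.1.le, hs.2.le⟩
      rw [Real.norm_eq_abs] at hb
      rw [Real.coe_toNNReal _ (by positivity)]
      simp only [Prod.dist_eq, Real.dist_eq, ← mul_sub, abs_mul]
      have m1 := le_max_left |p.1 - q.1| |p.2 - q.2|
      have m2 := le_max_right |p.1 - q.1| |p.2 - q.2|
      have m0 := (abs_nonneg _).trans m1
      refine max_le ?_ ?_
      · nlinarith
      · have := mul_le_mul hb m1 (abs_nonneg _) hM0
        nlinarith).lipschitzOnWith)
    ⟨by linarith, hT⟩ (fun s _ => (hf s).continuousAt.continuousWithinAt)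
    (fun s _ => hf s) (fun _ _ => mem_univ _) continuousOn_const
    (fun s _ => by
      simp only [Prod.fst_zero, Prod.snd_zero, mul_zero]
      exact hasDerivAt_const s 0)
    (fun _ _ => mem_univ _) (by simp [h0, h0'])
  exact congrArg Prod.fst (huniq ⟨by linarith [hθ.1], by linarith [hθ.2]⟩)

section Hierarchy

variable {Ω : Set (ℝ × ℝ)} {r : ℝ → ℝ → Fin 3 → ℝ} {u : ℕ → ℝ → ℝ → ℝ → ℝ}

theorem IsCorrectionHierarchy.contDiff (hu : IsCorrectionHierarchy Ω r u) (n : ℕ) {x t : ℝ}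
    (hx : (x, t) ∈ Ω) : ContDiff ℝ ∞ fun θ => u n θ x t :=
  (hu.smooth n).comp_contDiff (f := fun θ : ℝ => (θ, x, t)) (by fun_prop)
    fun θ => ⟨mem_univ θ, hx⟩

/-- The correction `u_n` has the parity of `n`: both `u_n(-θ)` and `(-1)^n u_n(θ)` solve the same
linear equation with the same value and derivative at `θ = 0`. -/
theorem IsCorrectionHierarchy.parity (hΩ : IsOpen Ω)
    (ho : ∀ x t, (x, t) ∈ Ω → Ordered (r x t)) (hu : IsCorrectionHierarchy Ω r u) (n : ℕ) :
    ∀ x t, (x, t) ∈ Ω → ∀ θ, u n (-θ) x t = (-1) ^ n * u n θ x t := by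
  induction n using Nat.strong_induction_on with
  | _ n ih =>
    intro x t hx θ
    rcases n with _ | n
    · rw [hu.lead x t hx, hu.lead x t hx, cnoidal_neg (ho x t hx), pow_zero, one_mul]
    have hF := forcing_neg hΩ (fun x t => waveK (r x t))
      (fun i hi => ih i (Nat.lt_succ_of_le hi)) hx
    have h0 : ∀ θ, u 0 (-θ) x t = u 0 θ x t := fun θ => by
      simpa using ih 0 (Nat.succ_pos n) x t hx θ
    have hk := (waveK_pos (ho x t hx)).ne'
    have hode := hu.ode n x t hx
    -- for even `n + 1` the two values at `0` agree by symmetry, for odd `n + 1` both vanish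
    have hz : u (n + 1) 0 x t - (-1) ^ (n + 1) * u (n + 1) 0 x t = 0 := by
      rcases Nat.even_or_odd' (n + 1) with ⟨c, hc | hc⟩
      · rw [hc, pow_mul]; simp
      · rw [hc, hu.odd_zero c x t hx]; simp
    have hz' := hu.deriv_zero n x t hx
    generalize (-1 : ℝ) ^ (n + 1) = σ at *
    have hw := hu.contDiff (n + 1) hx
    have hw' : ContDiff ℝ ∞ (deriv fun θ => u (n + 1) θ x t) :=
      ((contDiff_infty_iff_deriv (𝕜 := ℝ)).1 hw).2
    have d1 : ∀ θ, HasDerivAt (fun θ => u (n + 1) θ x t)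
        (deriv (fun θ => u (n + 1) θ x t) θ) θ :=
      fun θ => (hw.differentiable (by simp)).differentiableAt.hasDerivAt
    have d2 : ∀ θ, HasDerivAt (deriv fun θ => u (n + 1) θ x t)
        (deriv (deriv fun θ => u (n + 1) θ x t) θ) θ :=
      fun θ => (hw'.differentiable (by simp)).differentiableAt.hasDerivAt
    generalize hW : (fun θ => u (n + 1) θ x t) = W at *
    have hWθ : ∀ θ, u (n + 1) θ x t = W θ := fun θ => congrFun hW θ
    simp only [hWθ] at *
    have hneg : ∀ {f f' : ℝ → ℝ}, (∀ θ, HasDerivAt f (f' θ) θ) → ∀ θ,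
        HasDerivAt (fun θ => f (-θ)) (-f' (-θ)) θ := fun {f f'} h θ => by
      simpa [Function.comp_def] using (h (-θ)).scomp θ (hasDerivAt_neg θ)
    -- `u₀` is even and the forcing has parity `σ`, so the difference solves the homogeneous equation
    have hzero := eq_zero_of_deriv_deriv_eq_mul
      (a := fun θ => -(6 * u 0 θ x t - velV (r x t)) / waveK (r x t) ^ 2)
      (y := fun θ => W (-θ) - σ * W θ) (y' := fun θ => -deriv W (-θ) - σ * deriv W θ)
      (by have := (hu.contDiff 0 hx).continuous; fun_prop)
      (fun θ => (hneg d1 θ).fun_sub ((d1 θ).const_mul σ))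
      (fun θ => (((hneg d2 θ).fun_neg).fun_sub ((d2 θ).const_mul σ)).congr_deriv (by
        have e1 := hode θ
        have e2 := hode (-θ)
        rw [h0, hF] at e2
        field_simp
        linear_combination e2 - σ * e1)) (by simpa using hz) (by simp [hz']) θ
    exact sub_eq_zero.1 hzero

theorem IsCorrectionHierarchy.odd (hΩ : IsOpen Ω)
    (ho : ∀ x t, (x, t) ∈ Ω → Ordered (r x t)) (hu : IsCorrectionHierarchy Ω r u) {x t : ℝ}
    (hx : (x, t) ∈ Ω) (n : ℕ) (θ : ℝ) : u (2 * n + 1) (-θ) x t = -u (2 * n + 1) θ x t := by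
  rw [hu.parity hΩ ho _ x t hx, pow_succ, pow_mul]
  simp

theorem IsCorrectionHierarchy.avg_zero
    (ho : ∀ x t, (x, t) ∈ Ω → Ordered (r x t)) (hu : IsCorrectionHierarchy Ω r u) {x t : ℝ}
    (hx : (x, t) ∈ Ω) : avg (fun θ => u 0 θ x t) = meanQ0 (r x t) := by
  simp only [hu.lead x t hx]
  exact avg_cnoidal (ho x t hx)

/-- Only the terms of even order contribute to the mean. -/
theorem IsCorrectionHierarchy.avg_expansion (hΩ : IsOpen Ω)
    (ho : ∀ x t, (x, t) ∈ Ω → Ordered (r x t)) (hu : IsCorrectionHierarchy Ω r u) {x t : ℝ}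
    (hx : (x, t) ∈ Ω) (ε : ℝ) (N : ℕ) {w : ℝ → ℝ} (hw : Continuous w) :
    avg (fun θ => ∑ n ∈ Finset.range (2 * N + 2), ε ^ n * u n θ x t + ε ^ (2 * N + 2) * w θ) =
      meanQ0 (r x t) + ∑ i ∈ Finset.Icc 1 N, ε ^ (2 * i) * avg (fun θ => u (2 * i) θ x t)
        + ε ^ (2 * N + 2) * avg w := by
  have hc : ∀ n, Continuous fun θ => ε ^ n * u n θ x t :=
    fun n => continuous_const.mul (hu.contDiff n hx).continuous
  have hcw : Continuous fun θ => ε ^ (2 * N + 2) * w θ := continuous_const.mul hw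
  have hodd := fun n => 
    avg_eq_zero_of_odd (f := fun θ => u (2 * n + 1) θ x t) (hu.odd hΩ ho hx n)
  have hsum : ∀ N : ℕ, ∑ n ∈ Finset.range (2 * N + 2), ε ^ n * avg (fun θ => u n θ x t)
      = meanQ0 (r x t)
        + ∑ i ∈ Finset.Icc 1 N, ε ^ (2 * i) * avg (fun θ => u (2 * i) θ x t) := fun N => by
    induction N with
    | zero =>
      have := hodd 0
      simp only [mul_zero, zero_add] at this
      simp [Finset.sum_range_succ, this, hu.avg_zero ho hx]
    | succ N ih =>
      rw [show 2 * (N + 1) + 2 = 2 * N + 2 + 1 + 1 by ring, Finset.sum_range_succ,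
        Finset.sum_range_succ, ih, Finset.sum_Icc_succ_top (by omega),
        show 2 * N + 2 + 1 = 2 * (N + 1) + 1 by ring, hodd,
        show 2 * N + 2 = 2 * (N + 1) by ring]
      ring
  rw [← hsum, avg, intervalIntegral.integral_add
    ((continuous_finsetSum _ fun n _ => hc n).intervalIntegrable _ _)
    (hcw.intervalIntegrable _ _),
    intervalIntegral.integral_finsetSum fun n _ => (hc n).intervalIntegrable _ _]
  simp only [intervalIntegral.integral_const_mul]
  rfl

end Hierarchy

theorem integral_period_eq_zero_of_odd {f : ℝ → ℝ} (hf : ∀ θ, f (-θ) = -f θ)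
    (hp : Function.Periodic f 1) (a : ℝ) : ∫ θ in a..(a + 1), f θ = 0 := by
  rw [hp.intervalIntegral_add_eq a (-1 / 2), show (-1 / 2 : ℝ) + 1 = 1 / 2 by norm_num]
  exact avg_eq_zero_of_odd hf

/-! ### Smooth families of slow fields -/

/-- A family of slow fields `f p (x, t)`, depending on a parameter `p`, is smooth in all variables
jointly on the set `A` of triples `(p, x, t)`. -/
def SmoothFamily {P : Type} [NormedAddCommGroup P] [NormedSpace ℝ P] (A : Set (P × ℝ × ℝ))
    (f : P → ℝ → ℝ → ℝ) : Prop :=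
  ContDiffOn ℝ ∞ (fun p : P × ℝ × ℝ => f p.1 p.2.1 p.2.2) A

namespace SmoothFamily

variable {P : Type} [NormedAddCommGroup P] [NormedSpace ℝ P] {A : Set (P × ℝ × ℝ)}
  {f g : P → ℝ → ℝ → ℝ}

theorem const (c : ℝ) : SmoothFamily A (fun _ _ _ => c) := contDiffOn_const

theorem add (hf : SmoothFamily A f) (hg : SmoothFamily A g) :
    SmoothFamily A (fun p x t => f p x t + g p x t) := ContDiffOn.add hf hg

theorem sub (hf : SmoothFamily A f) (hg : SmoothFamily A g) :
    SmoothFamily A (fun p x t => f p x t - g p x t) := ContDiffOn.sub hf hg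

theorem mul (hf : SmoothFamily A f) (hg : SmoothFamily A g) :
    SmoothFamily A (fun p x t => f p x t * g p x t) := ContDiffOn.mul hf hg

theorem pow (hf : SmoothFamily A f) (n : ℕ) :
    SmoothFamily A (fun p x t => f p x t ^ n) := ContDiffOn.pow hf n

theorem div (hf : SmoothFamily A f) (hg : SmoothFamily A g)
    (h0 : ∀ p x t, (p, x, t) ∈ A → g p x t ≠ 0) :
    SmoothFamily A (fun p x t => f p x t / g p x t) :=
  ContDiffOn.div hf hg fun p hp => h0 p.1 p.2.1 p.2.2 hp

theorem hasFDerivAt (hA : IsOpen A) (hf : SmoothFamily A f) {p : P × ℝ × ℝ} (hp : p ∈ A) :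
    HasFDerivAt (fun p : P × ℝ × ℝ => f p.1 p.2.1 p.2.2)
      (fderiv ℝ (fun p : P × ℝ × ℝ => f p.1 p.2.1 p.2.2) p) p :=
  ((ContDiffOn.contDiffAt hf (hA.mem_nhds hp)).differentiableAt (by simp)).hasFDerivAt

theorem dx (hA : IsOpen A) (hf : SmoothFamily A f) : SmoothFamily A (fun p => dx (f p)) := by
  have h : ContDiffOn ℝ ∞ (fun p => fderiv ℝ (fun p : P × ℝ × ℝ => f p.1 p.2.1 p.2.2) p
      ((0, 1, 0) : P × ℝ × ℝ)) A :=
    (ContDiffOn.fderiv_of_isOpen hf hA (by simp)).clm_apply contDiffOn_const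
  refine h.congr fun p hp => ?_
  have hc : HasDerivAt (fun y : ℝ => (p.1, y, p.2.2)) ((0, 1, 0) : P × ℝ × ℝ) p.2.1 :=
    (hasDerivAt_const _ _).prodMk ((hasDerivAt_id _).prodMk (hasDerivAt_const _ _))
  exact ((hf.hasFDerivAt hA hp).comp_hasDerivAt p.2.1 hc).deriv

theorem dt (hA : IsOpen A) (hf : SmoothFamily A f) : SmoothFamily A (fun p => dt (f p)) := by
  have h : ContDiffOn ℝ ∞ (fun p => fderiv ℝ (fun p : P × ℝ × ℝ => f p.1 p.2.1 p.2.2) p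
      ((0, 0, 1) : P × ℝ × ℝ)) A :=
    (ContDiffOn.fderiv_of_isOpen hf hA (by simp)).clm_apply contDiffOn_const
  refine h.congr fun p hp => ?_
  have hc : HasDerivAt (fun s : ℝ => (p.1, p.2.1, s)) ((0, 0, 1) : P × ℝ × ℝ) p.2.2 :=
    (hasDerivAt_const _ _).prodMk ((hasDerivAt_const _ _).prodMk (hasDerivAt_id _))
  exact ((hf.hasFDerivAt hA hp).comp_hasDerivAt p.2.2 hc).deriv

end SmoothFamily

/-- The part of `Φ₂` without the explicit factor `ε²`. -/
noncomputable def Phi2Lead (k V C₁ Q : ℝ → ℝ → ℝ) : ℝ → ℝ → ℝ :=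
  let P : ℝ → ℝ → ℝ := fun x t => V x t * Q x t + C₁ x t
  let D : ℝ → ℝ → ℝ := Qd k Q
  fun x t => dt D x t
    + dx (fun x t => V x t * D x t + dx (dx P) x t / 2
        + 3 * dx k x t / (2 * k x t) * dx P x t + dx (dx k) x t / k x t * P x t) x t

/-- The coefficient of `-ε²` in `Φ₂`. -/
noncomputable def Phi2Disp (k Q : ℝ → ℝ → ℝ) : ℝ → ℝ → ℝ :=
  let D : ℝ → ℝ → ℝ := Qd k Q
  dx (fun x t => (k x t * dx (dx D) x t + 3 * dx k x t * dx D x t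
        + 2 * dx (dx k) x t * D x t) / (2 * k x t))

theorem Phi2_eq (ε : ℝ) (k V C₁ Q : ℝ → ℝ → ℝ) :
    Phi2 ε k V C₁ Q = fun x t => Phi2Lead k V C₁ Q x t - ε ^ 2 * Phi2Disp k Q x t := rfl

section Families

variable {P : Type} [NormedAddCommGroup P] [NormedSpace ℝ P] {A : Set (P × ℝ × ℝ)}
  {k V C₁ Q : P → ℝ → ℝ → ℝ}

theorem SmoothFamily.Phi1 (hA : IsOpen A) (hk : SmoothFamily A k) (hQ : SmoothFamily A Q)
    (h0 : ∀ p x t, (p, x, t) ∈ A → k p x t ≠ 0) :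
    SmoothFamily A (fun p => Phi1 (k p) (Q p)) :=
  ((((const 2).mul ((hQ.dx hA).dx hA)).add
    ((((const 3).mul (hk.dx hA)).div hk h0).mul (hQ.dx hA))).add
    ((((hk.dx hA).dx hA).div hk h0).mul hQ)).dx hA

theorem SmoothFamily.Qd (hA : IsOpen A) (hk : SmoothFamily A k) (hQ : SmoothFamily A Q)
    (h0 : ∀ p x t, (p, x, t) ∈ A → k p x t ≠ 0) :
    SmoothFamily A (fun p => Qd (k p) (Q p)) :=
  (((const 3).mul ((hk.mul (hQ.dx hA)).dx hA)).add (((hk.dx hA).dx hA).mul hQ)).div hk h0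

theorem SmoothFamily.Phi2Lead (hA : IsOpen A) (hk : SmoothFamily A k) (hV : SmoothFamily A V)
    (hC : SmoothFamily A C₁) (hQ : SmoothFamily A Q)
    (h0 : ∀ p x t, (p, x, t) ∈ A → k p x t ≠ 0) :
    SmoothFamily A (fun p => Phi2Lead (k p) (V p) (C₁ p) (Q p)) := by
  have hD := hk.Qd hA hQ h0
  have hP := (hV.mul hQ).add hC
  have h2 : ∀ p x t, (p, x, t) ∈ A → 2 * k p x t ≠ 0 := fun p x t h =>
    mul_ne_zero two_ne_zero (h0 p x t h)
  exact (hD.dt hA).add (((((hV.mul hD).add (((hP.dx hA).dx hA).div (const 2)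
    fun _ _ _ _ => two_ne_zero)).add
    ((((const 3).mul (hk.dx hA)).div ((const 2).mul hk) h2).mul (hP.dx hA))).add
    ((((hk.dx hA).dx hA).div hk h0).mul hP)).dx hA)

theorem SmoothFamily.Phi2Disp (hA : IsOpen A) (hk : SmoothFamily A k) (hQ : SmoothFamily A Q)
    (h0 : ∀ p x t, (p, x, t) ∈ A → k p x t ≠ 0) :
    SmoothFamily A (fun p => Phi2Disp (k p) (Q p)) := by
  have hD := hk.Qd hA hQ h0
  exact ((((hk.mul ((hD.dx hA).dx hA)).add (((const 3).mul (hk.dx hA)).mul (hD.dx hA))).add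
    (((const 2).mul ((hk.dx hA).dx hA)).mul hD)).div ((const 2).mul hk)
    fun p x t h => mul_ne_zero two_ne_zero (h0 p x t h)).dx hA

end Families

/-- A jointly smooth family changes by `O(δ)`, locally uniformly, when its first parameter moves
from `0` to `δ = ε²`. -/
theorem SmoothFamily.exists_bound {Ω : Set (ℝ × ℝ)} (hΩ : IsOpen Ω) {ε₀ : ℝ} (hε₀ : 0 < ε₀)
    {G : ℝ × ℝ → ℝ → ℝ → ℝ}
    (hG : SmoothFamily ((univ ×ˢ Ioo (-ε₀) ε₀) ×ˢ Ω) G) {C : Set (ℝ × ℝ)} (hC : C ⊆ Ω)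
    (hCc : IsCompact C) :
    ∃ M : ℝ, 0 ≤ M ∧ ∀ ε ∈ Ioo 0 (ε₀ / 2), ∀ x t, (x, t) ∈ C →
      |G (ε ^ 2, ε) x t - G (0, ε) x t| ≤ M * ε ^ 2 := by
  have hA : IsOpen (((univ : Set ℝ) ×ˢ Ioo (-ε₀) ε₀) ×ˢ Ω) := (isOpen_univ.prod isOpen_Ioo).prod hΩ
  have hsub : (Icc 0 (ε₀ ^ 2) ×ˢ Icc 0 (ε₀ / 2)) ×ˢ C
      ⊆ ((univ : Set ℝ) ×ˢ Ioo (-ε₀) ε₀) ×ˢ Ω :=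
    prod_mono (prod_mono (subset_univ _) fun ε hε =>
      ⟨by linarith [hε.1], by linarith [hε.2]⟩) hC
  obtain ⟨M, hM⟩ := ((isCompact_Icc.prod isCompact_Icc).prod hCc).exists_bound_of_continuousOn
    (((ContDiffOn.continuousOn_fderiv_of_isOpen hG hA (by simp)).clm_apply
      (continuousOn_const (c := (((1, 0), 0, 0) : (ℝ × ℝ) × ℝ × ℝ)))).mono hsub)
  refine ⟨max M 0, le_max_right _ _, fun ε hε x t hx => ?_⟩
  have hmem : ∀ δ ∈ Icc 0 (ε ^ 2),
      ((δ, ε), x, t) ∈ (Icc 0 (ε₀ ^ 2) ×ˢ Icc 0 (ε₀ / 2)) ×ˢ C := fun δ hδ =>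
    ⟨⟨⟨hδ.1, hδ.2.trans (pow_le_pow_left₀ hε.1.le (by linarith [hε.2]) 2)⟩,
      ⟨hε.1.le, hε.2.le⟩⟩, hx⟩
  have hd : ∀ δ ∈ Icc 0 (ε ^ 2), HasDerivWithinAt (fun δ => G (δ, ε) x t)
      (fderiv ℝ (fun p : (ℝ × ℝ) × ℝ × ℝ => G p.1 p.2.1 p.2.2) ((δ, ε), x, t)
        (((1, 0), 0, 0) : (ℝ × ℝ) × ℝ × ℝ)) (Icc 0 (ε ^ 2)) δ := fun δ hδ => by
    have hc : HasDerivAt (fun δ : ℝ => ((δ, ε), x, t))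
        (((1, 0), 0, 0) : (ℝ × ℝ) × ℝ × ℝ) δ :=
      ((hasDerivAt_id _).prodMk (hasDerivAt_const _ _)).prodMk
        ((hasDerivAt_const _ _).prodMk (hasDerivAt_const _ _))
    exact ((hG.hasFDerivAt hA (hsub (hmem δ hδ))).comp_hasDerivAt δ hc).hasDerivWithinAt
  have h := (convex_Icc 0 (ε ^ 2)).norm_image_sub_le_of_norm_hasDerivWithin_le (C := max M 0) hd
    (fun δ hδ => (hM _ (hmem δ hδ)).trans (le_max_left _ _))
    (left_mem_Icc.2 (sq_nonneg ε)) (right_mem_Icc.2 (sq_nonneg ε))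
  simpa [abs_of_nonneg (sq_nonneg ε)] using h

/-! ### Dependence of the correction term on the mean -/

section Congr

variable {Ω : Set (ℝ × ℝ)}

theorem dx_congr (hΩ : IsOpen Ω) {f g : ℝ → ℝ → ℝ} (h : ∀ x t, (x, t) ∈ Ω → f x t = g x t) :
    ∀ x t, (x, t) ∈ Ω → dx f x t = dx g x t := fun x t hx => by
  simpa using dx_eq_mul (σ := 1) hΩ (by simpa using h) hx

theorem dt_congr (hΩ : IsOpen Ω) {f g : ℝ → ℝ → ℝ} (h : ∀ x t, (x, t) ∈ Ω → f x t = g x t) :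
    ∀ x t, (x, t) ∈ Ω → dt f x t = dt g x t := fun x t hx => by
  simpa using dt_eq_mul (σ := 1) hΩ (by simpa using h) hx

variable {Q Q' : ℝ → ℝ → ℝ}

theorem Phi1_congr (hΩ : IsOpen Ω) (k : ℝ → ℝ → ℝ) (h : ∀ x t, (x, t) ∈ Ω → Q x t = Q' x t) :
    ∀ x t, (x, t) ∈ Ω → Phi1 k Q x t = Phi1 k Q' x t := by
  have h1 := dx_congr hΩ h
  have h2 := dx_congr hΩ h1
  exact dx_congr hΩ fun x t hx => by rw [h x t hx, h1 x t hx, h2 x t hx]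

theorem Phi2_congr (hΩ : IsOpen Ω) (ε : ℝ) (k V C₁ : ℝ → ℝ → ℝ)
    (h : ∀ x t, (x, t) ∈ Ω → Q x t = Q' x t) :
    ∀ x t, (x, t) ∈ Ω → Phi2 ε k V C₁ Q x t = Phi2 ε k V C₁ Q' x t := by
  have h1 := dx_congr hΩ h
  have hD : ∀ x t, (x, t) ∈ Ω → Qd k Q x t = Qd k Q' x t := fun x t hx => by
    rw [Qd, Qd, h x t hx, dx_congr hΩ (f := fun x t => k x t * dx Q x t)
      (g := fun x t => k x t * dx Q' x t) (fun x t hx => by rw [h1 x t hx]) x t hx]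
  have hD1 := dx_congr hΩ hD
  have hD2 := dx_congr hΩ hD1
  have hP : ∀ x t, (x, t) ∈ Ω → V x t * Q x t + C₁ x t = V x t * Q' x t + C₁ x t :=
    fun x t hx => by rw [h x t hx]
  have hP1 := dx_congr hΩ (f := fun x t => V x t * Q x t + C₁ x t)
    (g := fun x t => V x t * Q' x t + C₁ x t) hP
  have hP2 := dx_congr hΩ hP1
  intro x t hx
  refine congrArg₂ (· - ·) (congrArg₂ (· + ·) (dt_congr hΩ hD x t hx)
    (dx_congr hΩ (fun x t hx => ?_) x t hx))
    (congrArg (ε ^ 2 * ·) (dx_congr hΩ (fun x t hx => ?_) x t hx))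
  · simp only [hD x t hx, hP x t hx, hP1 x t hx, hP2 x t hx]
  · simp only [hD x t hx, hD1 x t hx, hD2 x t hx]

/-- On the open set `Ω` the correction depends only on the values of `q` and `Q` there. -/
theorem riemannCorrField_congr (hΩ : IsOpen Ω) (ε : ℝ) (r : ℝ → ℝ → Fin 3 → ℝ)
    {q q' : ℝ → ℝ → ℝ} (hq : ∀ x t, (x, t) ∈ Ω → q x t = q' x t)
    (hQ : ∀ x t, (x, t) ∈ Ω → Q x t = Q' x t) (j : Fin 3) {x t : ℝ} (hx : (x, t) ∈ Ω) :
    riemannCorrField ε r q Q j x t = riemannCorrField ε r q' Q' j x t := by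
  have hVq := fun (V : ℝ → ℝ → ℝ) x t (hx : (x, t) ∈ Ω) => congrArg (V x t * ·) (hq x t hx)
  simp only [riemannCorrField, X1, X2, Phi1_congr hΩ _ hQ x t hx,
    Phi2_congr hΩ _ _ _ _ hQ x t hx, dt_congr hΩ hq x t hx, dx_congr hΩ (hVq _) x t hx,
    dt_congr hΩ (hVq _) x t hx]

end Congr

/-! ### The error of the leading-order correction -/

theorem contDiffOn_avg {Ω : Set (ℝ × ℝ)} (hΩ : IsOpen Ω) {ε₀ : ℝ} {w : ℝ → ℝ → ℝ → ℝ → ℝ}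
    (hw : ContDiffOn ℝ ∞ (fun p : ℝ × ℝ × ℝ × ℝ => w p.1 p.2.1 p.2.2.1 p.2.2.2)
      (Ioo (-ε₀) ε₀ ×ˢ univ ×ˢ Ω)) :
    SmoothFamily (Ioo (-ε₀) ε₀ ×ˢ Ω) (fun ε x t => avg fun θ => w ε θ x t) :=
  contDiffOn_infty_intervalIntegral (isOpen_Ioo.prod hΩ)
    (f := fun p : (ℝ × ℝ × ℝ) × ℝ => w p.1.1 p.2 p.1.2.1 p.1.2.2)
    (hw.comp (f := fun p : (ℝ × ℝ × ℝ) × ℝ => (p.1.1, p.2, p.1.2.1, p.1.2.2))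
      (ContDiff.contDiffOn (by fun_prop)) fun _ hp => ⟨hp.1.1, mem_univ _, hp.1.2⟩) _ _

/-- The correction formed with the mean `Q₀ + δ (q + δ W)`, where `δ` replaces `ε²` everywhere;
the parameter is `(δ, ε)`. -/
noncomputable def corrFamily (r : ℝ → ℝ → ℝ → Fin 3 → ℝ) (q W : ℝ → ℝ → ℝ → ℝ) (j : Fin 3)
    (p : ℝ × ℝ) (x t : ℝ) : ℝ :=
  let k : ℝ → ℝ → ℝ := fun x t => waveK (r p.2 x t)
  let V : ℝ → ℝ → ℝ := fun x t => velV (r p.2 x t)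
  let C₁ : ℝ → ℝ → ℝ := fun x t => constC1 (r p.2 x t)
  let q' : ℝ → ℝ → ℝ := fun x t => q p.2 x t + p.1 * W p.2 x t
  let Q : ℝ → ℝ → ℝ := fun x t => meanQ0 (r p.2 x t) + p.1 * q' x t
  riemannCorr (r p.2 x t) (X1 V q' (Phi1 k Q) x t)
    (X2 V q' (fun x t => Phi2Lead k V C₁ Q x t - p.1 * Phi2Disp k Q x t) x t) j

theorem smoothFamily_corrFamily {Ω : Set (ℝ × ℝ)} (hΩ : IsOpen Ω) {ε₀ : ℝ}
    {r : ℝ → ℝ → ℝ → Fin 3 → ℝ} {q W : ℝ → ℝ → ℝ → ℝ}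
    (hr : ContDiffOn ℝ ∞ (fun p : ℝ × ℝ × ℝ => r p.1 p.2.1 p.2.2) (Ioo (-ε₀) ε₀ ×ˢ Ω))
    (ho : ∀ ε ∈ Ioo (-ε₀) ε₀, ∀ x t, (x, t) ∈ Ω → Ordered (r ε x t))
    (hq : SmoothFamily (Ioo (-ε₀) ε₀ ×ˢ Ω) q) (hW : SmoothFamily (Ioo (-ε₀) ε₀ ×ˢ Ω) W)
    (j : Fin 3) :
    SmoothFamily ((univ ×ˢ Ioo (-ε₀) ε₀) ×ˢ Ω) (corrFamily r q W j) := by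
  set A : Set ((ℝ × ℝ) × ℝ × ℝ) := (univ ×ˢ Ioo (-ε₀) ε₀) ×ˢ Ω
  have hA : IsOpen A := (isOpen_univ.prod isOpen_Ioo).prod hΩ
  have hmaps : MapsTo (fun p : (ℝ × ℝ) × ℝ × ℝ => (p.1.2, p.2)) A (Ioo (-ε₀) ε₀ ×ˢ Ω) :=
    fun p hp => ⟨hp.1.2, hp.2⟩
  have hproj : ContDiffOn ℝ ∞ (fun p : (ℝ × ℝ) × ℝ × ℝ => (p.1.2, p.2)) A :=
    ContDiff.contDiffOn (by fun_prop)
  have hoA : ∀ p x t, (p, x, t) ∈ A → Ordered (r p.2 x t) := fun p x t h => ho _ h.1.2 x t h.2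
  have hrA : ContDiffOn ℝ ∞ (fun p : (ℝ × ℝ) × ℝ × ℝ => r p.1.2 p.2.1 p.2.2) A :=
    ContDiffOn.comp (g := fun p : ℝ × ℝ × ℝ => r p.1 p.2.1 p.2.2) hr hproj hmaps
  have hcomp : ∀ {f : (Fin 3 → ℝ) → ℝ}, ContDiffOn ℝ ∞ f {r | Ordered r} →
      SmoothFamily A (fun p x t => f (r p.2 x t)) := fun hf =>
    ContDiffOn.comp hf hrA fun p hp => hoA p.1 p.2.1 p.2.2 hp
  have hk := hcomp contDiffOn_waveK
  have hk0 : ∀ p x t, (p, x, t) ∈ A → waveK (r p.2 x t) ≠ 0 :=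
    fun p x t h => (waveK_pos (hoA p x t h)).ne'
  have hV := hcomp contDiff_velV.contDiffOn
  have hC := hcomp contDiff_constC1.contDiffOn
  have hδ : SmoothFamily A (fun p _ _ => p.1) := ContDiff.contDiffOn (by fun_prop)
  have hqA : SmoothFamily A (fun p => q p.2) :=
    ContDiffOn.comp (g := fun p : ℝ × ℝ × ℝ => q p.1 p.2.1 p.2.2) hq hproj hmaps
  have hWA : SmoothFamily A (fun p => W p.2) :=
    ContDiffOn.comp (g := fun p : ℝ × ℝ × ℝ => W p.1 p.2.1 p.2.2) hW hproj hmaps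
  have hq' := hqA.add (hδ.mul hWA)
  have hQ := (hcomp contDiffOn_meanQ0).add (hδ.mul hq')
  have hX1 := ((hq'.dt hA).add ((hV.mul hq').dx hA)).sub (hk.Phi1 hA hQ hk0)
  have hX2 := (((hV.mul hq').dt hA).add (((hV.pow 2).mul hq').dx hA)).sub
    ((hk.Phi2Lead hA hV hC hQ hk0).sub (hδ.mul (hk.Phi2Disp hA hQ hk0)))
  have hcoord : ∀ i, SmoothFamily A (fun p x t => r p.2 x t i) := fun i =>
    hcomp (f := fun ρ => ρ i) (ContDiff.contDiffOn (by fun_prop))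
  have hnum := hX2.add (((SmoothFamily.const 6).mul
    (((hcoord j).sub (hcoord (j + 1))).sub (hcoord (j + 2)))).mul hX1)
  have hden := (((SmoothFamily.const 24).mul ((hcoord j).sub (hcoord (j + 1)))).mul
    ((hcoord j).sub (hcoord (j + 2)))).mul (hcomp (contDiffOn_logDerivK j))
  refine ContDiffOn.congr (hnum.div hden fun p x t h => ?_) fun p hp => ?_
  · have h1 := (hoA p x t h).sub_ne_zero j
    exact mul_ne_zero (mul_ne_zero (mul_ne_zero (by norm_num) h1.1) h1.2)
      (logDerivK_ne_zero (hoA p x t h) j)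
  · simp only [corrFamily, riemannCorr, partialK_div_waveK (hoA p.1 p.2.1 p.2.2 hp)]
    rfl

theorem riemannCorrField_eq_corrFamily_sq (ε : ℝ) (r : ℝ → ℝ → ℝ → Fin 3 → ℝ)
    (q W : ℝ → ℝ → ℝ → ℝ) (j : Fin 3) (x t : ℝ) :
    riemannCorrField ε (r ε) (fun x t => q ε x t + ε ^ 2 * W ε x t)
      (fun x t => meanQ0 (r ε x t) + ε ^ 2 * (q ε x t + ε ^ 2 * W ε x t)) j x t
      = corrFamily r q W j (ε ^ 2, ε) x t := rfl

theorem riemannCorrField_eq_corrFamily_zero (ε : ℝ) (r : ℝ → ℝ → ℝ → Fin 3 → ℝ)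
    (q W : ℝ → ℝ → ℝ → ℝ) (j : Fin 3) (x t : ℝ) :
    riemannCorrField 0 (r ε) (fun x t => q ε x t) (fun x t => meanQ0 (r ε x t)) j x t
      = corrFamily r q W j (0, ε) x t := by
  simp [corrFamily, riemannCorrField, Phi2_eq]

/-- With `Q` the mean of the expansion up to order `ε³` plus a remainder of order `ε⁴`, the
correction term is the one formed with `q₂` and `Q₀` up to `O(ε²)`. -/
theorem exists_bound_leading_correction {Ω : Set (ℝ × ℝ)} (hΩ : IsOpen Ω) {ε₀ : ℝ}
    {r : ℝ → ℝ → ℝ → Fin 3 → ℝ} {u : ℝ → ℕ → ℝ → ℝ → ℝ → ℝ} {w : ℝ → ℝ → ℝ → ℝ → ℝ}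
    {Q : ℝ → ℝ → ℝ → ℝ} (hε₀ : 0 < ε₀)
    (hr : ContDiffOn ℝ ∞ (fun p : ℝ × ℝ × ℝ => r p.1 p.2.1 p.2.2) (Ioo (-ε₀) ε₀ ×ˢ Ω))
    (ho : ∀ ε ∈ Ioo (-ε₀) ε₀, ∀ x t, (x, t) ∈ Ω → Ordered (r ε x t))
    (hu : ∀ n, ContDiffOn ℝ ∞ (fun p : ℝ × ℝ × ℝ × ℝ => u p.1 n p.2.1 p.2.2.1 p.2.2.2)
      (Ioo (-ε₀) ε₀ ×ˢ univ ×ˢ Ω))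
    (hw : ContDiffOn ℝ ∞ (fun p : ℝ × ℝ × ℝ × ℝ => w p.1 p.2.1 p.2.2.1 p.2.2.2)
      (Ioo (-ε₀) ε₀ ×ˢ univ ×ˢ Ω))
    (hh : ∀ ε ∈ Ioo 0 ε₀, IsCorrectionHierarchy Ω (r ε) (u ε))
    (hQ : ∀ ε ∈ Ioo 0 ε₀, ∀ x t, (x, t) ∈ Ω →
      Q ε x t = avg (fun θ => u ε 0 θ x t + ε * u ε 1 θ x t + ε ^ 2 * u ε 2 θ x t
        + ε ^ 3 * u ε 3 θ x t + ε ^ 4 * w ε θ x t))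
    {C : Set (ℝ × ℝ)} (hC : C ⊆ Ω) (hCc : IsCompact C) :
    ∃ M δ : ℝ, 0 < δ ∧ ∀ ε ∈ Ioo 0 (min δ ε₀), ∀ x t, (x, t) ∈ C → ∀ j,
      |(riemannLead (r ε) j x t + ε ^ 2 * riemannCorrField ε (r ε)
            (fun x t => (Q ε x t - meanQ0 (r ε x t)) / ε ^ 2) (Q ε) j x t)
        - (riemannLead (r ε) j x t + ε ^ 2 * riemannCorrField 0 (r ε)
            (fun x t => avg (fun θ => u ε 2 θ x t)) (fun x t => meanQ0 (r ε x t)) j x t)|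
      ≤ M * ε ^ 4 := by
  set q : ℝ → ℝ → ℝ → ℝ := fun ε x t => avg fun θ => u ε 2 θ x t
  set W : ℝ → ℝ → ℝ → ℝ := fun ε x t => avg fun θ => w ε θ x t
  have hb := fun j => (smoothFamily_corrFamily hΩ hr ho
    (contDiffOn_avg hΩ (w := fun ε => u ε 2) (hu 2)) (contDiffOn_avg hΩ hw) j).exists_bound
    hΩ hε₀ hC hCc
  choose M hM0 hM using hb
  refine ⟨∑ j, M j, ε₀ / 2, by positivity, fun ε hε x t hx j => ?_⟩
  have hε2 : ε < ε₀ / 2 := hε.2.trans_le (min_le_left _ _)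
  have hε' : ε ∈ Ioo 0 ε₀ := ⟨hε.1, hε.2.trans_le (min_le_right _ _)⟩
  have hQ' : ∀ x t, (x, t) ∈ Ω →
      Q ε x t = meanQ0 (r ε x t) + ε ^ 2 * (q ε x t + ε ^ 2 * W ε x t) := fun x t hx => by
    have hexp := (hh ε hε').avg_expansion hΩ (ho ε ⟨by linarith [hε.1], hε'.2⟩) hx ε 1
      (w := fun θ => w ε θ x t)
      (hw.continuousOn.comp_continuous (f := fun θ : ℝ => (ε, θ, x, t)) (by fun_prop)
        fun θ => ⟨⟨by linarith [hε.1], hε'.2⟩, mem_univ θ, hx⟩)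
    simp only [mul_one, Finset.sum_range_succ, Finset.range_zero, Finset.sum_empty, zero_add,
      pow_zero, one_mul, pow_one, Finset.Icc_self, Finset.sum_singleton, Nat.reduceAdd] at hexp
    rw [hQ ε hε' x t hx, hexp]
    ring
  have hq' : ∀ x t, (x, t) ∈ Ω →
      (Q ε x t - meanQ0 (r ε x t)) / ε ^ 2 = q ε x t + ε ^ 2 * W ε x t := fun x t hx => by
    have := hε.1.ne'
    rw [hQ' x t hx]
    field_simp
    ring
  rw [riemannCorrField_congr hΩ ε (r ε) hq' hQ' j (hC hx), riemannCorrField_eq_corrFamily_sq,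
    riemannCorrField_eq_corrFamily_zero ε r q W, add_sub_add_left_eq_sub, ← mul_sub, abs_mul,
    abs_of_nonneg (sq_nonneg ε)]
  have h1 := hM j ε ⟨hε.1, hε2⟩ x t hx
  have h2 : M j ≤ ∑ j, M j := Finset.single_le_sum (fun i _ => hM0 i) (Finset.mem_univ j)
  calc _ ≤ ε ^ 2 * (M j * ε ^ 2) := mul_le_mul_of_nonneg_left h1 (sq_nonneg ε)
    _ = M j * ε ^ 4 := by ring
    _ ≤ (∑ j, M j) * ε ^ 4 := mul_le_mul_of_nonneg_right h2 (by positivity)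

end WhithamKdV

theorem mainTheorem3 (Ω : Set (ℝ × ℝ)) (hΩ : IsOpen Ω) :
    -- the denominators do not vanish
    (∀ r : Fin 3 → ℝ, WhithamKdV.Ordered r →
      0 < WhithamKdV.waveK r ∧ ∀ j, WhithamKdV.partialK j r ≠ 0) ∧
    -- the `r_j` are the Riemann variables of the classical system
    (∀ r : ℝ → ℝ → Fin 3 → ℝ,
      ContDiffOn ℝ ∞ (fun p : ℝ × ℝ => r p.1 p.2) Ω →
      (∀ x t, (x, t) ∈ Ω → WhithamKdV.Ordered (r x t)) →
      ∀ x t, (x, t) ∈ Ω →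
        (WhithamKdV.ClassicalWhitham r x t ↔ ∀ j, WhithamKdV.riemannLead r j x t = 0)) ∧
    -- the all-orders Whitham equations in Riemann form, with `q = (Q - Q₀) / ε²`
    (∀ (ε : ℝ) (r : ℝ → ℝ → Fin 3 → ℝ) (Q : ℝ → ℝ → ℝ), ε ≠ 0 →
      ContDiffOn ℝ ∞ (fun p : ℝ × ℝ => r p.1 p.2) Ω →
      (∀ x t, (x, t) ∈ Ω → WhithamKdV.Ordered (r x t)) →
      ContDiffOn ℝ ∞ (fun p : ℝ × ℝ => Q p.1 p.2) Ω →
      ∀ x t, (x, t) ∈ Ω →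
        (WhithamKdV.AllOrdersWhitham ε r Q x t ↔
          ∀ j, WhithamKdV.riemannLead r j x t + ε ^ 2 *
            WhithamKdV.riemannCorrField ε r
              (fun x t => (Q x t - WhithamKdV.meanQ0 (r x t)) / ε ^ 2) Q j x t = 0)) ∧
    -- the odd-order corrections are odd in `θ` and have zero mean, and therefore
    -- `Q = Q₀ + ε² (q₂ + ε² q₄ + ⋯)`
    (∀ (r : ℝ → ℝ → Fin 3 → ℝ) (u : ℕ → ℝ → ℝ → ℝ → ℝ),
      ContDiffOn ℝ ∞ (fun p : ℝ × ℝ => r p.1 p.2) Ω →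
      (∀ x t, (x, t) ∈ Ω → WhithamKdV.Ordered (r x t)) →
      WhithamKdV.IsCorrectionHierarchy Ω r u →
      ∀ x t, (x, t) ∈ Ω →
        WhithamKdV.avg (fun θ => u 0 θ x t) = WhithamKdV.meanQ0 (r x t) ∧
        (∀ n θ, u (2 * n + 1) (-θ) x t = -u (2 * n + 1) θ x t) ∧
        (∀ n, WhithamKdV.avg (fun θ => u (2 * n + 1) θ x t) = 0) ∧
        (∀ n, Function.Periodic (fun θ => u (2 * n + 1) θ x t) 1 →
          ∀ a : ℝ, ∫ θ in a..(a + 1), u (2 * n + 1) θ x t = 0) ∧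
        (∀ (ε : ℝ) (N : ℕ) (w : ℝ → ℝ), Continuous w →
          WhithamKdV.avg (fun θ => ∑ n ∈ Finset.range (2 * N + 2), ε ^ n * u n θ x t
              + ε ^ (2 * N + 2) * w θ) =
            WhithamKdV.meanQ0 (r x t)
              + ∑ i ∈ Finset.Icc 1 N, ε ^ (2 * i) * WhithamKdV.avg (fun θ => u (2 * i) θ x t)
              + ε ^ (2 * N + 2) * WhithamKdV.avg w)) ∧
    -- to order `ε²` the Riemann form is the classical one plus `ε²` times the correction formed
    -- with `q₂` (the mean of `u₂`) and with `Φ₁, Φ₂` at leading order (`Q = Q₀`, `ε = 0`); the error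
    -- is `O(ε⁴)`, locally uniformly in `(x, t)`
    (∀ (ε₀ : ℝ) (r : ℝ → ℝ → ℝ → Fin 3 → ℝ) (u : ℝ → ℕ → ℝ → ℝ → ℝ → ℝ)
        (w : ℝ → ℝ → ℝ → ℝ → ℝ) (Q : ℝ → ℝ → ℝ → ℝ), 0 < ε₀ →
      ContDiffOn ℝ ∞ (fun p : ℝ × ℝ × ℝ => r p.1 p.2.1 p.2.2) (Set.Ioo (-ε₀) ε₀ ×ˢ Ω) →
      (∀ ε ∈ Set.Ioo (-ε₀) ε₀, ∀ x t, (x, t) ∈ Ω → WhithamKdV.Ordered (r ε x t)) →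
      (∀ n, ContDiffOn ℝ ∞ (fun p : ℝ × ℝ × ℝ × ℝ => u p.1 n p.2.1 p.2.2.1 p.2.2.2)
        (Set.Ioo (-ε₀) ε₀ ×ˢ Set.univ ×ˢ Ω)) →
      ContDiffOn ℝ ∞ (fun p : ℝ × ℝ × ℝ × ℝ => w p.1 p.2.1 p.2.2.1 p.2.2.2)
        (Set.Ioo (-ε₀) ε₀ ×ˢ Set.univ ×ˢ Ω) →
      (∀ ε ∈ Set.Ioo 0 ε₀, WhithamKdV.IsCorrectionHierarchy Ω (r ε) (u ε)) →
      (∀ ε ∈ Set.Ioo 0 ε₀, ∀ x t, (x, t) ∈ Ω →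
        Q ε x t = WhithamKdV.avg (fun θ => u ε 0 θ x t + ε * u ε 1 θ x t + ε ^ 2 * u ε 2 θ x t
          + ε ^ 3 * u ε 3 θ x t + ε ^ 4 * w ε θ x t)) →
      ∀ C ⊆ Ω, IsCompact C →
        ∃ M δ : ℝ, 0 < δ ∧ ∀ ε ∈ Set.Ioo 0 (min δ ε₀), ∀ x t, (x, t) ∈ C → ∀ j,
          |(WhithamKdV.riemannLead (r ε) j x t + ε ^ 2 *
              WhithamKdV.riemannCorrField ε (r ε)
                (fun x t => (Q ε x t - WhithamKdV.meanQ0 (r ε x t)) / ε ^ 2) (Q ε) j x t)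
            - (WhithamKdV.riemannLead (r ε) j x t + ε ^ 2 *
              WhithamKdV.riemannCorrField 0 (r ε)
                (fun x t => WhithamKdV.avg (fun θ => u ε 2 θ x t))
                (fun x t => WhithamKdV.meanQ0 (r ε x t)) j x t)|
          ≤ M * ε ^ 4) := by
  refine ⟨fun r h => ⟨WhithamKdV.waveK_pos h, WhithamKdV.partialK_ne_zero h⟩,
    fun r hr ho x t hx => WhithamKdV.classicalWhitham_iff (ho x t hx)
      ((hr.contDiffAt (hΩ.mem_nhds hx)).differentiableAt (by simp)),
    fun ε r Q hε hr ho hQ x t hx => WhithamKdV.allOrdersWhitham_iff hε (ho x t hx)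
      ((hr.contDiffAt (hΩ.mem_nhds hx)).differentiableAt (by simp))
      ((hQ.contDiffAt (hΩ.mem_nhds hx)).differentiableAt (by simp)),
    fun r u _ ho hu x t hx => ⟨hu.avg_zero ho hx, hu.odd hΩ ho hx,
      fun n => WhithamKdV.avg_eq_zero_of_odd (hu.odd hΩ ho hx n),
      fun n => WhithamKdV.integral_period_eq_zero_of_odd (hu.odd hΩ ho hx n),
      fun ε N w hw => hu.avg_expansion hΩ ho hx ε N hw⟩,
    fun ε₀ r u w Q hε₀ hr ho hu hw hh hQ C hC hCc =>
      WhithamKdV.exists_bound_leading_correction hΩ hε₀ hr ho hu hw hh hQ hC hCc⟩
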